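/- Let $H_1,H_2\in(0,\tfrac12)\cup(\tfrac12,1]$, $H=H_1+H_2$, $\alpha_1,\alpha_2,\nu_1,\nu_2>0$. Let $B=(B^1_t,B^2_t)_{t\in\mathbb R}$ be a bivariate fractional Brownian motion: a centered Gaussian process in $\mathbb R^2$ such that each $B^i$ is a fractional Brownian motion with Hurst index $H_i$ (almost surely continuous, with $\mathrm{Cov}(B^i_t,B^i_s)=\tfrac12(|t|^{2H_i}+|s|^{2H_i}-|t-s|^{2H_i})$), such that $(B^1_{\lambda t},B^2_{\lambda t})_t$ and $(\lambda^{H_1}B^1_t,\lambda^{H_2}B^2_t)_t$ have the same finite-dimensional distributions for every $\lambda>0$, and with stationary increments. Let $Y=(Y^1_t,Y^2_t)_{t\in\mathbb R}$ be the bivariate fractional Ornstein-Uhlenbeck process driven by $B$, i.e. the centered Gaussian process with, for every $t$, almost surely $$Y^i_t=\nu_i\int_{-\infty}^t e^{-\alpha_i(t-u)}\,dB^i_u$$ (a pathwise improper Riemann-Stieltjes integral). Then the cross-covariance of $B$ has the following form: there are $\rho=\mathrm{Corr}(B^1_1,B^2_1)\in[-1,1]$ and $\eta_{12}=-\eta_{21}\in\mathbb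 R$ such that for $i\ne j$ and all $t,s\in\mathbb R$, with $\mathrm{sign}(x)=1$ for $x\ge 0$ and $-1$ for $x<0$ and with $0\log 0=0$, $$\mathrm{Cov}(B^i_t,B^j_s)=\tfrac12\big((\rho+\mathrm{sign}(t)\eta_{ij})|t|^{H}+(\rho-\mathrm{sign}(s)\eta_{ij})|s|^{H}-(\rho-\mathrm{sign}(s-t)\eta_{ij})|s-t|^{H}\big)\quad\text{if }H\ne1,$$ $$\mathrm{Cov}(B^i_t,B^j_s)=\tfrac12\big(\rho(|s|+|t|-|s-t|)+\eta_{ij}(s\log|s|-t\log|t|-(s-t)\log|s-t|)\big)\quad\text{if }H=1.$$ For these parameters, for all $i\neq j$ in $\{1,2\}$, every $N\in\mathbb N=\{0,1,2,\dots\}$ and every fixed $t\in\mathbb R$, as $s\to\infty$: if $H\neq1$, $$\mathrm{Cov}(Y^i_t,Y^j_{t+s})=\frac{\nu_1\nu_2(\rho+\eta_{ji})}{2(\alpha_1+\alpha_2)}\sum_{n=0}^N\Big(\frac{(-1)^n}{\alpha_j^{n+1}}+\frac1{\alpha_i^{n+1}}\Big)\Big(\prod_{k=0}^{n+1}(H-k)\Big)s^{H-2-n}+O(s^{H-N-3});$$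 if $H=1$, $$\mathrm{Cov}(Y^i_t,Y^j_{t+s})=\frac{\nu_1\nu_2\,\eta_{ij}}{2\alpha_1\alpha_2}\,\frac1s+\frac{\nu_1\nu_2\,\eta_{ij}}{2(\alpha_1+\alpha_2)}\sum_{n=1}^N\Big(\frac{(-1)^n}{\alpha_j^{n+1}}+\frac1{\alpha_i^{n+1}}\Big)\Big(\prod_{k=0}^{n-1}(-k-1)\Big)s^{-1-n}+O(s^{-N-2}).$$ -/

import Mathlib

open MeasureTheory ProbabilityTheory Filter Topology Asymptotics

/-- The sign convention `sign : ℝ → {-1, 1}` with `sign 0 = 1`. -/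
noncomputable def pmSign (x : ℝ) : ℝ := if 0 ≤ x then 1 else -1

/-- `I` is the Riemann-Stieltjes integral `∫_a^b f dg`: the Riemann-Stieltjes sums over tagged
partitions `a = x 0 ≤ x 1 ≤ ⋯ ≤ x n = b` converge to `I` as the mesh tends to zero. -/
def HasRiemannStieltjesIntegral (f g : ℝ → ℝ) (a b I : ℝ) : Prop :=
  ∀ ε : ℝ, 0 < ε → ∃ δ : ℝ, 0 < δ ∧ ∀ (n : ℕ) (x ξ : ℕ → ℝ),
    x 0 = a → x n = b →
    (∀ k < n, x k ≤ x (k + 1) ∧ x (k + 1) - x k < δ ∧ ξ k ∈ Set.Icc (x k) (x (k + 1))) →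
    |∑ k ∈ Finset.range n, f (ξ k) * (g (x (k + 1)) - g (x k)) - I| < ε

/-- `I` is the improper Riemann-Stieltjes integral `∫_{-∞}^t f dg`. -/
def HasImproperRiemannStieltjesIntegral (f g : ℝ → ℝ) (t I : ℝ) : Prop :=
  ∃ F : ℝ → ℝ, (∀ a < t, HasRiemannStieltjesIntegral f g a t (F a)) ∧ Tendsto F atBot (𝓝 I)

/-- `X` is a (two-sided, normalized) fractional Brownian motion with Hurst index `h`. -/
structure IsFBm {Ω : Type*} [MeasurableSpace Ω] (P : Measure Ω) (h : ℝ) (X : ℝ → Ω → ℝ) :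
    Prop where
  gaussian : IsGaussianProcess X P
  centered : ∀ t, ∫ ω, X t ω ∂P = 0
  cov_eq : ∀ t s, cov[X t, X s; P]
    = (|t| ^ (2 * h) + |s| ^ (2 * h) - |t - s| ^ (2 * h)) / 2
  continuous_paths : ∀ᵐ ω ∂P, Continuous fun t => X t ω

/-- `B = (B 0, B 1)` is a bivariate fractional Brownian motion with Hurst indexes `(h 0, h 1)`:
an `ℝ²`-valued centered Gaussian process whose components are fractional Brownian motions, which is
jointly self-similar and has stationary increments.  The process is viewed as a real process
indexed by pairs (component, time), and equality in the sense of finite-dimensional distributions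
is tested on finite sets of such pairs. -/
structure IsBivariateFBm {Ω : Type*} [MeasurableSpace Ω] (P : Measure Ω) (h : Fin 2 → ℝ)
    (B : Fin 2 → ℝ → Ω → ℝ) : Prop where
  gaussian : IsGaussianProcess (fun p : Fin 2 × ℝ => B p.1 p.2) P
  fBm : ∀ i, IsFBm P (h i) (B i)
  selfSimilar : ∀ c : ℝ, 0 < c → ∀ I : Finset (Fin 2 × ℝ),
    IdentDistrib (fun ω (p : I) => B p.1.1 (c * p.1.2) ω)
      (fun ω (p : I) => c ^ h p.1.1 * B p.1.1 p.1.2 ω) P P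
  stationaryIncrements : ∀ u : ℝ, ∀ I : Finset (Fin 2 × ℝ),
    IdentDistrib (fun ω (p : I) => B p.1.1 (p.1.2 + u) ω - B p.1.1 u ω)
      (fun ω (p : I) => B p.1.1 p.1.2 ω - B p.1.1 0 ω) P P

/-- `ρ` and the antisymmetric `η` are the parameters of the cross-covariance of `B`: `ρ` is the
correlation of the components at time `1`, and `η` is determined by the general form of the
cross-covariance function of a bivariate fractional Brownian motion with unit variances at time
`1`. -/
structure IsCrossCovParam {Ω : Type*} [MeasurableSpace Ω] (P : Measure Ω) (h : Fin 2 → ℝ)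
    (B : Fin 2 → ℝ → Ω → ℝ) (ρ : ℝ) (η : Fin 2 → Fin 2 → ℝ) : Prop where
  rho_mem : ρ ∈ Set.Icc (-1 : ℝ) 1
  rho_eq : ρ = cov[B 0 1, B 1 1; P] / (√(Var[B 0 1; P]) * √(Var[B 1 1; P]))
  eta_antisymm : ∀ i j, η i j = -η j i
  cov_of_ne_one : h 0 + h 1 ≠ 1 → ∀ i j, i ≠ j → ∀ t s : ℝ,
    cov[B i t, B j s; P] =
      ((ρ + pmSign t * η i j) * |t| ^ (h 0 + h 1) + (ρ - pmSign s * η i j) * |s| ^ (h 0 + h 1)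
        - (ρ - pmSign (s - t) * η i j) * |s - t| ^ (h 0 + h 1)) / 2
  cov_of_eq_one : h 0 + h 1 = 1 → ∀ i j, i ≠ j → ∀ t s : ℝ,
    cov[B i t, B j s; P] =
      (ρ * (|s| + |t| - |s - t|)
        + η i j * (s * Real.log |s| - t * Real.log |t| - (s - t) * Real.log |s - t|)) / 2

/-- `Y = (Y 0, Y 1)` is the bivariate (stationary) fractional Ornstein-Uhlenbeck process driven by
`B`: a centered Gaussian process with
`Y i t = ν i * ∫_{-∞}^t exp (-α i * (t - u)) dB i u` almost surely, for every `t`, as a pathwise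
(improper) Riemann-Stieltjes integral. -/
structure IsBivariateFOU {Ω : Type*} [MeasurableSpace Ω] (P : Measure Ω) (α ν : Fin 2 → ℝ)
    (B Y : Fin 2 → ℝ → Ω → ℝ) : Prop where
  gaussian : IsGaussianProcess (fun p : Fin 2 × ℝ => Y p.1 p.2) P
  centered : ∀ i t, ∫ ω, Y i t ω ∂P = 0
  eq_integral : ∀ i t, ∀ᵐ ω ∂P, ∃ I : ℝ,
    HasImproperRiemannStieltjesIntegral (fun u => Real.exp (-α i * (t - u))) (fun u => B i u ω) t I
      ∧ Y i t ω = ν i * I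

/-!
The cross-covariance of `B` has the form `Cov(B i u, B j v) = c v + c (-u) - c (v - u)`, where `c` is
`powerKernel` if `H = h 0 + h 1 ≠ 1` and `logKernel` if `H = 1`.

*The form of the covariance.*  On the lattice `ℤ`, stationarity of the increments gives the
displayed identity for a second antidifference `c` of the covariances of unit increments, normalized
by `c 0 = c 1 = 0`.  Self-similarity turns into `c (p * k) = p ^ H * c k + k * c p` for `p ≥ 1`
(`lattice_kernel_mul`).  If `H ≠ 1`, exchanging `p` and `k = 2` gives `c p = κ * (p ^ H - p)`.  If
`H = 1`, then `c p / p` is completely additive and, by continuity of the covariance, has increments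
tending to `0`; hence it is a multiple of the logarithm
(`exists_eq_mul_log_of_completelyAdditive`).  Taking `k = -1` gives the negative half-line, and
self-similarity with continuity passes from `ℤ` to `ℚ` and to `ℝ` (`eq_of_eq_on_lattice`).

*The covariance of `Y`.*  Almost sure limits of centered Gaussian variables are centered Gaussian,
and covariances pass to the limit (`IsCenteredGaussianSpace.aeLimits`, `tendsto_covariance`).  Since
`Y i t` is obtained from Riemann-Stieltjes sums of `B i` by two almost sure limits, for `Z` in the
Gaussian space `Cov(Y i t, Z)` is the same improper integral of the deterministic function
`u ↦ Cov(B i u, Z)`, so that no stochastic Fubini theorem and no growth of the paths is needed.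
After integration by parts it is `ν i * E[g t - g (t - X)]` with `g u = Cov(B i u, Z)` and `X`
exponential of rate `α i`.  Applying this twice,
`Cov(Y i t, Y j (t + s)) = ν i * ν j * E[c (s + X) - c s + c (s - X') - c (s + X - X')]`
for independent exponential variables `X`, `X'` of rates `α i`, `α j` (`covariance_fOU_of_kernel`).

*The expansion.*  Insert the Taylor polynomial of degree `N + 2` of `c` at `s`.  Its remainder at
`s + z` is `O(s ^ (H - N - 3))` times a power of `1 + |z|`, uniformly in all real `z`
(`exists_abs_sub_taylor_le`), hence stays `O(s ^ (H - N - 3))` in expectation.  The terms of degree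
`0` and `1` cancel, and the term of degree `n + 2` contributes
`c⁽ⁿ⁺²⁾(s) * ((-1) ^ n / α j ^ (n + 1) + 1 / α i ^ (n + 1)) / (α i + α j)`, a geometric sum of
normalized moments (`integral_increment_pow_expMeasure`).
-/

/-! ### Linear spaces of centered Gaussian variables -/

section GaussianSpace

variable {Ω : Type*} [MeasurableSpace Ω] {P : Measure Ω}

/-- A linear space of random variables all of whose elements are centered Gaussian. -/
def IsCenteredGaussianSpace (P : Measure Ω) (M : Submodule ℝ (Ω → ℝ)) : Prop :=
  ∀ X ∈ M, HasGaussianLaw X P ∧ ∫ ω, X ω ∂P = 0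

/-- The space of almost sure limits of sequences of elements of `M`. -/
def aeLimits (P : Measure Ω) (M : Submodule ℝ (Ω → ℝ)) : Submodule ℝ (Ω → ℝ) where
  carrier := {X | ∃ Z : ℕ → Ω → ℝ, (∀ n, Z n ∈ M) ∧
    ∀ᵐ ω ∂P, Tendsto (fun n => Z n ω) atTop (𝓝 (X ω))}
  add_mem' := by
    rintro X X' ⟨Z, hZ, hl⟩ ⟨Z', hZ', hl'⟩
    refine ⟨fun n => Z n + Z' n, fun n => M.add_mem (hZ n) (hZ' n), ?_⟩
    filter_upwards [hl, hl'] with ω h h' using h.add h'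
  zero_mem' := ⟨0, fun _ => M.zero_mem, by simp⟩
  smul_mem' := by
    rintro r X ⟨Z, hZ, hl⟩
    refine ⟨fun n => r • Z n, fun n => M.smul_mem r (hZ n), ?_⟩
    filter_upwards [hl] with ω h using h.const_smul r

lemma le_aeLimits (P : Measure Ω) (M : Submodule ℝ (Ω → ℝ)) : M ≤ aeLimits P M :=
  fun X hX => ⟨fun _ => X, fun _ => hX, by simp⟩

lemma isCenteredGaussianSpace_span {T : Type*} {X : T → Ω → ℝ} (hX : IsGaussianProcess X P)
    (h0 : ∀ t, ∫ ω, X t ω ∂P = 0) :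
    IsCenteredGaussianSpace P (Submodule.span ℝ (Set.range X)) := by
  intro Z hZ
  obtain ⟨c, rfl⟩ := (Finsupp.mem_span_range_iff_exists_finsupp).1 hZ
  have e : (c.sum fun i a => a • X i) = fun ω => ∑ i ∈ c.support, c i • X i ω := by
    ext ω
    simp [Finsupp.sum, Finset.sum_apply]
  rw [e]
  refine ⟨(hX.smul fun i => c i).hasGaussianLaw_fun_sum, ?_⟩
  have h := integral_finsetSum c.support (f := fun i ω => c i • X i ω) (μ := P)
    fun i _ => (hX.hasGaussianLaw_eval i).integrable.smul (c i)
  refine h.trans (Finset.sum_eq_zero fun i _ => ?_)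
  rw [integral_smul, h0, smul_zero]

namespace IsCenteredGaussianSpace

variable {M : Submodule ℝ (Ω → ℝ)}

lemma memLp (hM : IsCenteredGaussianSpace P M) {X : Ω → ℝ} (hX : X ∈ M) : MemLp X 2 P :=
  (hM X hX).1.memLp_two

lemma charFun_eq (hM : IsCenteredGaussianSpace P M) {X : Ω → ℝ} (hX : X ∈ M) (θ : ℝ) :
    charFun (P.map X) θ = ((Real.exp (-(Var[X; P] * θ ^ 2 / 2)) : ℝ) : ℂ) := by
  have h := (hM X hX).1
  have : IsProbabilityMeasure P := h.isProbabilityMeasure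
  rw [h.map_eq_gaussianReal, charFun_gaussianReal, (hM X hX).2,
    Real.coe_toNNReal _ (variance_nonneg _ _)]
  push_cast
  congr 1
  ring

lemma tendsto_charFun [IsProbabilityMeasure P] {Z : ℕ → Ω → ℝ} {X : Ω → ℝ}
    (hZ : ∀ n, AEMeasurable (Z n) P) (hX : AEMeasurable X P)
    (hl : ∀ᵐ ω ∂P, Tendsto (fun n => Z n ω) atTop (𝓝 (X ω))) (θ : ℝ) :
    Tendsto (fun n => charFun (P.map (Z n)) θ) atTop (𝓝 (charFun (P.map X) θ)) := by
  have e : ∀ W : Ω → ℝ, AEMeasurable W P →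
      charFun (P.map W) θ = ∫ ω, Complex.exp (θ * W ω * Complex.I) ∂P := by
    intro W hW
    rw [charFun_apply_real, integral_map hW (by fun_prop)]
  rw [e X hX]
  simp_rw [fun n => e (Z n) (hZ n)]
  refine tendsto_integral_of_dominated_convergence (fun _ => 1) ?_ (by simp) ?_ ?_
  · intro n
    have := hZ n
    exact AEMeasurable.aestronglyMeasurable (by fun_prop)
  · intro n
    refine ae_of_all _ fun ω => ?_
    rw [← Complex.ofReal_mul, Complex.norm_exp_ofReal_mul_I]
  · filter_upwards [hl] with ω h
    have hc : Continuous fun x : ℝ => Complex.exp (θ * x * Complex.I) := by fun_prop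
    exact (hc.tendsto (X ω)).comp h

/-- Almost sure limits of centered Gaussian variables are centered Gaussian: the characteristic
functions `exp (-V n * θ ^ 2 / 2)` converge to one that does not vanish near `0`, which forces the
variances `V n` to converge. -/
lemma aeLimits [IsProbabilityMeasure P] (hM : IsCenteredGaussianSpace P M) :
    IsCenteredGaussianSpace P (aeLimits P M) := by
  rintro X ⟨Z, hZ, hl⟩
  have hZm : ∀ n, AEMeasurable (Z n) P := fun n => (hM _ (hZ n)).1.aemeasurable
  have hXm : AEMeasurable X P := aemeasurable_of_tendsto_metrizable_ae atTop hZm hl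
  have hprob : IsProbabilityMeasure (P.map X) := Measure.isProbabilityMeasure_map hXm
  have hφ := fun θ => tendsto_charFun hZm hXm hl θ
  simp_rw [fun n => hM.charFun_eq (hZ n)] at hφ
  -- a nonzero frequency at which the limit does not vanish
  obtain ⟨θ₀, hθ₀, hne⟩ : ∃ θ₀ : ℝ, θ₀ ≠ 0 ∧ charFun (P.map X) θ₀ ≠ 0 := by
    have hc : ContinuousAt (charFun (P.map X)) 0 := continuous_charFun.continuousAt
    have h1 : charFun (P.map X) 0 ≠ 0 := by simp
    have h2 : ∀ᶠ θ in 𝓝[≠] (0 : ℝ), charFun (P.map X) θ ≠ 0 :=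
      (hc.eventually_ne h1).filter_mono nhdsWithin_le_nhds
    obtain ⟨θ, h3, h4⟩ := (h2.and self_mem_nhdsWithin).exists
    exact ⟨θ, h4, h3⟩
  have hV : ∃ V, 0 ≤ V ∧ Tendsto (fun n => Var[Z n; P]) atTop (𝓝 V) := by
    have h1 := (hφ θ₀).norm
    simp only [Complex.norm_real, Real.norm_eq_abs, Real.abs_exp] at h1
    have h2 := (h1.log (norm_ne_zero_iff.2 hne))
    simp only [Real.log_exp] at h2
    have h3 := h2.const_mul (-2 / θ₀ ^ 2)
    have h4 : Tendsto (fun n => Var[Z n; P]) atTop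
        (𝓝 (-2 / θ₀ ^ 2 * Real.log ‖charFun (P.map X) θ₀‖)) := by
      refine h3.congr fun n => ?_
      field_simp
    exact ⟨_, ge_of_tendsto' h4 fun n => variance_nonneg _ _, h4⟩
  obtain ⟨V, hV0, hV⟩ := hV
  have hlaw : P.map X = gaussianReal 0 V.toNNReal := by
    refine Measure.ext_of_charFun (funext fun θ => ?_)
    have hc : Continuous fun v : ℝ => ((Real.exp (-(v * θ ^ 2 / 2)) : ℝ) : ℂ) := by fun_prop
    refine tendsto_nhds_unique (hφ θ) ?_
    have h5 := (hc.tendsto V).comp hV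
    have e : charFun (gaussianReal 0 V.toNNReal) θ
        = ((Real.exp (-(V * θ ^ 2 / 2)) : ℝ) : ℂ) := by
      rw [charFun_gaussianReal, Real.coe_toNNReal _ hV0]
      push_cast
      congr 1
      ring
    rw [e]
    exact h5
  have hXg : HasGaussianLaw X P := ⟨by rw [hlaw]; infer_instance⟩
  refine ⟨hXg, ?_⟩
  have h6 : ∫ x, x ∂(P.map X) = 0 := by rw [hlaw]; exact integral_id_gaussianReal
  rwa [integral_map hXm (by fun_prop)] at h6

end IsCenteredGaussianSpace

/-- The Cauchy-Schwarz inequality for the covariance. -/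
lemma abs_covariance_le [IsProbabilityMeasure P] {X Z : Ω → ℝ} (hX : MemLp X 2 P)
    (hZ : MemLp Z 2 P) : |cov[X, Z; P]| ≤ √(Var[X; P]) * √(Var[Z; P]) := by
  have key : ∀ r : ℝ, 0 ≤ Var[Z; P] * (r * r) + 2 * cov[X, Z; P] * r + Var[X; P] := by
    intro r
    have h := variance_nonneg (fun ω => X ω + r * Z ω) P
    have h2 : Var[fun ω => X ω + r * Z ω; P]
        = Var[X; P] + 2 * cov[X, fun ω => r * Z ω; P] + Var[fun ω => r * Z ω; P] :=
      variance_fun_add hX (hZ.const_mul r)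
    rw [h2, covariance_const_mul_right, variance_const_mul] at h
    linarith
  have h3 := discrim_le_zero key
  rw [discrim] at h3
  rw [← Real.sqrt_mul (variance_nonneg _ _)]
  refine Real.abs_le_sqrt ?_
  linarith

namespace IsCenteredGaussianSpace

variable {M : Submodule ℝ (Ω → ℝ)}

/-- An almost surely convergent sequence of a Gaussian space converges in `L²`: the differences
`Z n - X` are centered Gaussian and tend to `0` in law, so their variances tend to `0`. -/
lemma tendsto_covariance [IsProbabilityMeasure P] (hM : IsCenteredGaussianSpace P M)
    {Z : ℕ → Ω → ℝ} {X W : Ω → ℝ} (hZ : ∀ n, Z n ∈ M) (hX : X ∈ M) (hW : W ∈ M)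
    (hl : ∀ᵐ ω ∂P, Tendsto (fun n => Z n ω) atTop (𝓝 (X ω))) :
    Tendsto (fun n => cov[Z n, W; P]) atTop (𝓝 (cov[X, W; P])) := by
  have hD : ∀ n, Z n - X ∈ M := fun n => M.sub_mem (hZ n) hX
  have hDl : ∀ᵐ ω ∂P, Tendsto (fun n => (Z n - X) ω) atTop (𝓝 ((0 : Ω → ℝ) ω)) := by
    filter_upwards [hl] with ω h
    simpa using h.sub_const (X ω)
  have h1 := tendsto_charFun (fun n => (hM _ (hD n)).1.aemeasurable)
    (hM _ M.zero_mem).1.aemeasurable hDl 1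
  simp_rw [fun n => hM.charFun_eq (hD n), hM.charFun_eq M.zero_mem] at h1
  have h2 := h1.norm
  simp only [Complex.norm_real, Real.norm_eq_abs, Real.abs_exp] at h2
  have h3 := (h2.log (Real.exp_ne_zero _)).const_mul (-2)
  simp only [Real.log_exp] at h3
  have hV : Tendsto (fun n => Var[Z n - X; P]) atTop (𝓝 0) := by
    have e : -2 * -(Var[(0 : Ω → ℝ); P] * 1 ^ 2 / 2) = 0 := by simp
    rw [e] at h3
    refine h3.congr fun n => ?_
    ring
  rw [tendsto_iff_norm_sub_tendsto_zero]
  have h4 : Tendsto (fun n => √(Var[Z n - X; P]) * √(Var[W; P])) atTop (𝓝 0) := by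
    simpa using (hV.sqrt).mul_const (√(Var[W; P]))
  refine squeeze_zero (fun _ => norm_nonneg _) (fun n => ?_) h4
  rw [← covariance_sub_left (hM.memLp (hZ n)) (hM.memLp hX) (hM.memLp hW)]
  exact abs_covariance_le (hM.memLp (hD n)) (hM.memLp hW)

end IsCenteredGaussianSpace

end GaussianSpace

/-! ### Exponential laws and Riemann-Stieltjes integrals of deterministic functions -/

section ExponentialLaw

variable {r : ℝ}

lemma expMeasure_eq_withDensity (r : ℝ) :
    expMeasure r = (volume.restrict (Set.Ioi (0 : ℝ))).withDensity
      fun x => ENNReal.ofReal (r * Real.exp (-(r * x))) := by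
  have h : expMeasure r = volume.withDensity (exponentialPDF r) := rfl
  have h0 : exponentialPDF r =ᵐ[volume] (Set.Ioi (0 : ℝ)).indicator
      fun x => ENNReal.ofReal (r * Real.exp (-(r * x))) := by
    have : ∀ᵐ x : ℝ ∂volume, x ≠ 0 := by simp [ae_iff]
    filter_upwards [this] with x hx
    rw [exponentialPDF_eq]
    rcases lt_or_gt_of_ne hx with hx | hx
    · simp [hx.not_ge, hx.not_gt]
    · simp [hx.le, hx]
  rw [h, withDensity_congr_ae h0, withDensity_indicator measurableSet_Ioi]

lemma integral_expMeasure (hr : 0 < r) (f : ℝ → ℝ) :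
    ∫ x, f x ∂(expMeasure r) = ∫ x in Set.Ioi 0, r * Real.exp (-(r * x)) * f x := by
  rw [expMeasure_eq_withDensity r,
    integral_withDensity_eq_integral_toReal_smul (by fun_prop) (by simp)]
  refine integral_congr_ae (ae_of_all _ fun x => ?_)
  have : 0 ≤ r * Real.exp (-(r * x)) := by positivity
  simp [ENNReal.toReal_ofReal this]

lemma integrable_expMeasure_iff (hr : 0 < r) {f : ℝ → ℝ} :
    Integrable f (expMeasure r) ↔
      IntegrableOn (fun x => r * Real.exp (-(r * x)) * f x) (Set.Ioi 0) := by
  rw [expMeasure_eq_withDensity r,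
    integrable_withDensity_iff_integrable_smul' (by fun_prop) (by simp), IntegrableOn]
  refine integrable_congr (ae_of_all _ fun x => ?_)
  have : 0 ≤ r * Real.exp (-(r * x)) := by positivity
  simp [ENNReal.toReal_ofReal this]

lemma ae_nonneg_expMeasure (r : ℝ) : ∀ᵐ x ∂(expMeasure r), 0 ≤ x := by
  rw [expMeasure_eq_withDensity r]
  refine (withDensity_absolutelyContinuous _ _).ae_le ?_
  filter_upwards [ae_restrict_mem measurableSet_Ioi] with x hx using le_of_lt hx

lemma integrable_pow_expMeasure (hr : 0 < r) (n : ℕ) :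
    Integrable (fun x => x ^ n) (expMeasure r) := by
  rw [integrable_expMeasure_iff hr]
  have h := integrableOn_rpow_mul_exp_neg_mul_rpow (s := n) (p := 1) (b := r)
    (by have : (0 : ℝ) ≤ n := n.cast_nonneg
        linarith) one_pos hr
  refine (h.const_mul r).congr (ae_of_all _ fun x => ?_)
  simp only [Real.rpow_natCast, Real.rpow_one, neg_mul]
  ring

lemma integral_pow_expMeasure (hr : 0 < r) (n : ℕ) :
    ∫ x, x ^ n ∂(expMeasure r) = n.factorial / r ^ n := by
  rw [integral_expMeasure hr]
  have h := Real.integral_rpow_mul_exp_neg_mul_Ioi (a := n + 1) (r := r) (by positivity) hr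
  have e : ∀ x : ℝ, r * Real.exp (-(r * x)) * x ^ n
      = r * (x ^ ((n : ℝ) + 1 - 1) * Real.exp (-(r * x))) := by
    intro x
    rw [add_sub_cancel_right, Real.rpow_natCast]
    ring
  simp_rw [e]
  rw [integral_const_mul, h, Real.Gamma_nat_eq_factorial]
  rw [Real.rpow_add_one (by positivity), Real.rpow_natCast, one_div, inv_pow]
  field_simp

lemma integrable_one_add_abs_pow_expMeasure (hr : 0 < r) (p : ℕ) :
    Integrable (fun x => (1 + |x|) ^ p) (expMeasure r) := by
  have h : Integrable (fun x : ℝ => (x + 1) ^ p) (expMeasure r) := by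
    simp_rw [add_pow, one_pow, mul_one]
    exact integrable_finsetSum _ fun k _ => (integrable_pow_expMeasure hr k).mul_const _
  refine h.congr ?_
  filter_upwards [ae_nonneg_expMeasure r] with x hx
  rw [abs_of_nonneg hx, add_comm]

end ExponentialLaw

section RiemannStieltjes

/-- The left-endpoint Riemann-Stieltjes sum of `∫_a^b f dg` over the partition of `[a, b]` into
`m + 1` intervals of equal length. -/
noncomputable def uniformRSSum (f g : ℝ → ℝ) (a b : ℝ) (m : ℕ) : ℝ :=
  ∑ k ∈ Finset.range (m + 1), f (a + k * ((b - a) / (m + 1))) *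
    (g (a + (k + 1 : ℕ) * ((b - a) / (m + 1))) - g (a + k * ((b - a) / (m + 1))))

lemma tendsto_div_add_one_nat (x : ℝ) : Tendsto (fun m : ℕ => x / (m + 1)) atTop (𝓝 0) := by
  have h := tendsto_one_div_add_atTop_nhds_zero_nat (𝕜 := ℝ)
  simpa [div_eq_mul_inv] using h.const_mul x

lemma HasRiemannStieltjesIntegral.tendsto_uniformRSSum {f g : ℝ → ℝ} {a b I : ℝ}
    (h : HasRiemannStieltjesIntegral f g a b I) (hab : a ≤ b) :
    Tendsto (uniformRSSum f g a b) atTop (𝓝 I) := by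
  rw [Metric.tendsto_atTop']
  intro ε hε
  obtain ⟨δ, hδ, hs⟩ := h ε hε
  have h1 : ∀ᶠ m : ℕ in atTop, (b - a) / (m + 1) < δ :=
    (tendsto_div_add_one_nat (b - a)).eventually_lt_const hδ
  obtain ⟨m₀, hm₀⟩ := eventually_atTop.1 h1
  refine ⟨m₀, fun m hm => ?_⟩
  have hd : 0 ≤ (b - a) / ((m : ℝ) + 1) := div_nonneg (by linarith) (by positivity)
  have := hs (m + 1) (fun k => a + k * ((b - a) / (m + 1)))
    (fun k => a + k * ((b - a) / (m + 1))) (by simp) (by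
      push_cast
      field_simp
      ring) (by
      intro k _
      have h2 := hm₀ m hm.le
      push_cast
      refine ⟨by linarith, by linarith, le_rfl, by linarith⟩)
  rw [Real.dist_eq]
  exact this

lemma sum_mul_sub_eq_abel (F G : ℕ → ℝ) (n : ℕ) :
    ∑ k ∈ Finset.range n, F k * (G (k + 1) - G k)
      = F n * G n - F 0 * G 0 - ∑ k ∈ Finset.range n, G (k + 1) * (F (k + 1) - F k) := by
  induction n with
  | zero => simp
  | succ n ih => rw [Finset.sum_range_succ, Finset.sum_range_succ, ih]; ring

/-- Integration by parts for the Riemann-Stieltjes integral with a continuously differentiable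
integrand. -/
lemma tendsto_uniformRSSum_of_hasDerivAt {f f' g : ℝ → ℝ} {a b : ℝ} (hab : a ≤ b)
    (hf : ∀ x, HasDerivAt f (f' x) x) (hf' : Continuous f') (hg : Continuous g) :
    Tendsto (uniformRSSum f g a b) atTop
      (𝓝 (f b * g b - f a * g a - ∫ u in a..b, f' u * g u)) := by
  obtain ⟨C, hC⟩ := isCompact_Icc.exists_bound_of_continuousOn (s := Set.Icc a b) hf'.continuousOn
  have hC0 : 0 ≤ C := (norm_nonneg _).trans (hC a ⟨le_rfl, hab⟩)
  have huc := isCompact_Icc.uniformContinuousOn_of_continuous (s := Set.Icc a b) hg.continuousOn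
  rw [Metric.tendsto_atTop']
  intro ε hε
  obtain ⟨δ, hδ, hgδ⟩ := Metric.uniformContinuousOn_iff.1 huc (ε / (C * (b - a) + 1)) (by
    have : 0 ≤ C * (b - a) := mul_nonneg hC0 (by linarith)
    positivity)
  have h1 : ∀ᶠ m : ℕ in atTop, (b - a) / (m + 1) < δ :=
    (tendsto_div_add_one_nat (b - a)).eventually_lt_const hδ
  obtain ⟨m₀, hm₀⟩ := eventually_atTop.1 h1
  refine ⟨m₀, fun m hm => ?_⟩
  set d : ℝ := (b - a) / (m + 1) with hd_def
  have hd : 0 ≤ d := div_nonneg (by linarith) (by positivity)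
  have hdδ : d < δ := hm₀ m hm.le
  set x : ℕ → ℝ := fun k => a + k * d with hx
  have hx0 : x 0 = a := by simp [hx]
  have hmd : ((m : ℝ) + 1) * d = b - a := by
    rw [hd_def]; field_simp
  have hxn : x (m + 1) = b := by
    simp only [hx]; push_cast; linarith
  have hstep : ∀ k, x (k + 1) = x k + d := by
    intro k; simp only [hx]; push_cast; ring
  have hmem : ∀ k < m + 1, a ≤ x k ∧ x (k + 1) ≤ b := by
    intro k hk
    have hk' : ((k + 1 : ℕ) : ℝ) ≤ m + 1 := by exact_mod_cast hk
    have h2 : ((k + 1 : ℕ) : ℝ) * d ≤ b - a := by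
      rw [← hmd]; exact mul_le_mul_of_nonneg_right hk' hd
    refine ⟨?_, ?_⟩
    · simp only [hx]; have : 0 ≤ (k : ℝ) * d := by positivity
      linarith
    · simp only [hx]; linarith
  have hsum : uniformRSSum f g a b m
      = f b * g b - f a * g a
        - ∑ k ∈ Finset.range (m + 1), g (x (k + 1)) * (f (x (k + 1)) - f (x k)) := by
    have := sum_mul_sub_eq_abel (fun k => f (x k)) (fun k => g (x k)) (m + 1)
    rw [hx0, hxn] at this
    rw [← this]
    rfl
  have hfg : Continuous fun u => f' u * g u := hf'.mul hg
  have hint : ∀ φ : ℝ → ℝ, Continuous φ → ∀ k, IntervalIntegrable φ volume (x k) (x (k + 1)) :=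
    fun φ hφ k => hφ.intervalIntegrable _ _
  have hI : ∫ u in a..b, f' u * g u
      = ∑ k ∈ Finset.range (m + 1), ∫ u in x k..x (k + 1), f' u * g u := by
    rw [intervalIntegral.sum_integral_adjacent_intervals fun k _ => hint _ hfg k, hx0, hxn]
  have hfk : ∀ k, f (x (k + 1)) - f (x k) = ∫ u in x k..x (k + 1), f' u := fun k =>
    (intervalIntegral.integral_eq_sub_of_hasDerivAt (fun u _ => hf u) (hint _ hf' k)).symm
  rw [Real.dist_eq, hsum, hI, sub_sub_sub_cancel_left, ← Finset.sum_sub_distrib]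
  have hterm : ∀ k ∈ Finset.range (m + 1),
      |(∫ u in x k..x (k + 1), f' u * g u) - g (x (k + 1)) * (f (x (k + 1)) - f (x k))|
        ≤ C * (ε / (C * (b - a) + 1)) * d := by
    intro k hk
    obtain ⟨hka, hkb⟩ := hmem k (Finset.mem_range.1 hk)
    have hle : x k ≤ x (k + 1) := by rw [hstep]; linarith
    rw [hfk, ← intervalIntegral.integral_const_mul, ← intervalIntegral.integral_sub
      (hint _ hfg k) (hint (fun u => g (x (k + 1)) * f' u) (by fun_prop) k)]
    have := intervalIntegral.norm_integral_le_of_norm_le_const (a := x k) (b := x (k + 1))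
      (f := fun u => f' u * g u - g (x (k + 1)) * f' u) (C := C * (ε / (C * (b - a) + 1))) (by
        intro u hu
        rw [Set.uIoc_of_le hle] at hu
        have hu' : u ∈ Set.Icc a b := ⟨by linarith [hu.1], by linarith [hu.2]⟩
        have hxk : x (k + 1) ∈ Set.Icc a b := ⟨by linarith, hkb⟩
        have h3 := hgδ u hu' _ hxk (by
          rw [Real.dist_eq, abs_sub_comm, abs_of_nonneg (by linarith [hu.2])]
          linarith [hu.1, hstep k])
        rw [show f' u * g u - g (x (k + 1)) * f' u = f' u * (g u - g (x (k + 1))) by ring, norm_mul]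
        exact mul_le_mul (hC u hu') (by rw [← dist_eq_norm]; exact h3.le) (norm_nonneg _) hC0)
    rwa [Real.norm_eq_abs, show |x (k + 1) - x k| = d by
      rw [hstep, add_sub_cancel_left, abs_of_nonneg hd]] at this
  refine (Finset.abs_sum_le_sum_abs _ _).trans_lt ((Finset.sum_le_sum hterm).trans_lt ?_)
  rw [Finset.sum_const, Finset.card_range, nsmul_eq_mul]
  push_cast
  have h0 : 0 ≤ C * (b - a) := mul_nonneg hC0 (by linarith)
  calc ((m : ℝ) + 1) * (C * (ε / (C * (b - a) + 1)) * d)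
      = C * (ε / (C * (b - a) + 1)) * (((m : ℝ) + 1) * d) := by ring
    _ = (C * (b - a)) / (C * (b - a) + 1) * ε := by rw [hmd]; ring
    _ < ε := by
        have : (C * (b - a)) / (C * (b - a) + 1) < 1 := by
          rw [div_lt_one (by linarith)]; linarith
        nlinarith

/-- The limit as `a → -∞` of the integration by parts formula for the exponential kernel, written
as an expectation under the exponential law. -/
lemma tendsto_integral_by_parts_exp {α t K : ℝ} (hα : 0 < α) {g : ℝ → ℝ} (hg : Continuous g)
    (hK : ∀ u, |g u| ≤ K * (1 + |u|)) :
    Tendsto (fun a : ℝ => Real.exp (-α * (t - t)) * g t - Real.exp (-α * (t - a)) * g a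
        - ∫ u in a..t, α * Real.exp (-α * (t - u)) * g u) atBot
      (𝓝 (∫ x, (g t - g (t - x)) ∂(expMeasure α))) := by
  have hprob := isProbabilityMeasure_expMeasure hα
  have hK0 : 0 ≤ K := by
    have := (abs_nonneg _).trans (hK 0)
    simpa using this
  have hint : Integrable (fun x => g (t - x)) (expMeasure α) := by
    refine Integrable.mono' (((integrable_one_add_abs_pow_expMeasure hα 1).const_mul
      (K * (1 + |t|)))) (by fun_prop) (ae_of_all _ fun x => ?_)
    rw [Real.norm_eq_abs, pow_one]
    refine (hK _).trans ?_
    rw [mul_assoc]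
    refine mul_le_mul_of_nonneg_left ?_ hK0
    have := abs_sub t x
    nlinarith [mul_nonneg (abs_nonneg t) (abs_nonneg x)]
  rw [integral_sub (integrable_const _) hint, integral_const, integral_expMeasure hα]
  simp only [sub_self, mul_zero, Real.exp_zero, one_mul, probReal_univ, smul_eq_mul]
  have htop : Tendsto (fun a : ℝ => t - a) atBot atTop :=
    tendsto_atTop_add_const_left _ t tendsto_neg_atBot_atTop
  have h1 : Tendsto (fun a : ℝ => Real.exp (-α * (t - a)) * g a) atBot (𝓝 0) := by
    have h2 : Tendsto (fun y : ℝ => Real.exp (-α * y) * (K * ((1 + |t|) + y))) atTop (𝓝 0) := by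
      have h3 := Real.tendsto_pow_mul_exp_neg_atTop_nhds_zero 1
      have h4 : Tendsto (fun y : ℝ => α * y) atTop atTop := tendsto_id.const_mul_atTop hα
      have h5 := (h3.comp h4).const_mul (K / α)
      have h6 := (Real.tendsto_exp_neg_atTop_nhds_zero.comp h4).const_mul (K * (1 + |t|))
      have h7 := h6.add h5
      simp only [mul_zero, add_zero] at h7
      refine h7.congr fun y => ?_
      simp only [Function.comp_apply, pow_one, neg_mul]
      field_simp
    refine squeeze_zero_norm' ?_ (h2.comp htop)
    filter_upwards [eventually_le_atBot t] with a ha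
    rw [norm_mul, Real.norm_eq_abs, Real.abs_exp, Real.norm_eq_abs]
    refine mul_le_mul_of_nonneg_left ((hK a).trans ?_) (Real.exp_nonneg _)
    refine mul_le_mul_of_nonneg_left ?_ hK0
    have h8 : |a| ≤ |t| + (t - a) := by
      have h9 := abs_sub_abs_le_abs_sub a t
      rw [abs_sub_comm, abs_of_nonneg (by linarith : 0 ≤ t - a)] at h9
      linarith
    linarith
  have h2 : Tendsto (fun a : ℝ => ∫ u in a..t, α * Real.exp (-α * (t - u)) * g u) atBot
      (𝓝 (∫ x in Set.Ioi 0, α * Real.exp (-(α * x)) * g (t - x))) := by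
    have h3 := (intervalIntegral_tendsto_integral_Ioi 0
      ((integrable_expMeasure_iff hα).1 hint) tendsto_id).comp htop
    refine h3.congr fun a => ?_
    have h4 := intervalIntegral.integral_comp_sub_left (a := a) (b := t)
      (fun x => α * Real.exp (-(α * x)) * g (t - x)) t
    simp only [sub_self, sub_sub_cancel] at h4
    simp only [Function.comp_apply, id_eq]
    rw [← h4]
    refine intervalIntegral.integral_congr fun u _ => ?_
    simp only [neg_mul]
  simpa using (h1.const_sub (g t)).sub h2

end RiemannStieltjes

/-! ### Covariances of the Ornstein-Uhlenbeck process -/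

section OrnsteinUhlenbeck

lemma uniformRSSum_process_eq {Ω : Type*} (X : ℝ → Ω → ℝ) (f : ℝ → ℝ) (a b : ℝ) (m : ℕ) :
    (fun ω => uniformRSSum f (fun u => X u ω) a b m)
      = ∑ k ∈ Finset.range (m + 1), f (a + k * ((b - a) / (m + 1))) •
        (X (a + (k + 1 : ℕ) * ((b - a) / (m + 1))) - X (a + k * ((b - a) / (m + 1)))) := by
  ext ω
  simp [uniformRSSum, Finset.sum_apply]

lemma uniformRSSum_mem {Ω : Type*} {M : Submodule ℝ (Ω → ℝ)} {X : ℝ → Ω → ℝ} (hX : ∀ u, X u ∈ M)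
    (f : ℝ → ℝ) (a b : ℝ) (m : ℕ) :
    (fun ω => uniformRSSum f (fun u => X u ω) a b m) ∈ M := by
  rw [uniformRSSum_process_eq]
  exact M.sum_mem fun k _ => M.smul_mem _ (M.sub_mem (hX _) (hX _))

variable {Ω : Type*} [MeasurableSpace Ω] {P : Measure Ω}

lemma covariance_uniformRSSum [IsProbabilityMeasure P] {M : Submodule ℝ (Ω → ℝ)}
    (hM : IsCenteredGaussianSpace P M) {X : ℝ → Ω → ℝ} (hX : ∀ u, X u ∈ M) {Z : Ω → ℝ}
    (hZ : Z ∈ M) (f : ℝ → ℝ) (a b : ℝ) (m : ℕ) :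
    cov[fun ω => uniformRSSum f (fun u => X u ω) a b m, Z; P]
      = uniformRSSum f (fun u => cov[X u, Z; P]) a b m := by
  rw [uniformRSSum_process_eq, covariance_sum_left' (fun k _ =>
    ((hM.memLp (hX _)).sub (hM.memLp (hX _))).const_smul _) (hM.memLp hZ)]
  refine Finset.sum_congr rfl fun k _ => ?_
  rw [covariance_smul_left,
    covariance_sub_left (hM.memLp (hX _)) (hM.memLp (hX _)) (hM.memLp hZ)]

/-- A pathwise improper Riemann-Stieltjes integral against `X` is obtained from the variables
`X u` by taking almost sure limits twice: `F n` is the integral over `[t - (n + 1), t]`. -/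
lemma exists_approx_of_improperIntegral {M : Submodule ℝ (Ω → ℝ)} {X : ℝ → Ω → ℝ}
    (hX : ∀ u, X u ∈ M) {f : ℝ → ℝ} {t ν : ℝ} {Y : Ω → ℝ}
    (hY : ∀ᵐ ω ∂P, ∃ I : ℝ, HasImproperRiemannStieltjesIntegral f (fun u => X u ω) t I ∧
      Y ω = ν * I) :
    ∃ F : ℕ → Ω → ℝ, (∀ n, F n ∈ aeLimits P M) ∧
      (∀ n, ∀ᵐ ω ∂P, Tendsto (fun m => uniformRSSum f (fun u => X u ω) (t - (n + 1 : ℕ)) t m) atTop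
        (𝓝 (F n ω))) ∧
      ∀ᵐ ω ∂P, Tendsto (fun n => ν * F n ω) atTop (𝓝 (Y ω)) := by
  have hlt : ∀ n : ℕ, t - (n + 1 : ℕ) < t := fun n => by
    have : (0 : ℝ) < (n + 1 : ℕ) := by positivity
    linarith
  set F : ℕ → Ω → ℝ := fun n ω =>
    limUnder atTop (fun m => uniformRSSum f (fun u => X u ω) (t - (n + 1 : ℕ)) t m) with hF
  have hFl : ∀ n, ∀ᵐ ω ∂P, Tendsto
      (fun m => uniformRSSum f (fun u => X u ω) (t - (n + 1 : ℕ)) t m) atTop (𝓝 (F n ω)) := by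
    intro n
    filter_upwards [hY] with ω ⟨I, ⟨G, hG, _⟩, _⟩
    exact tendsto_nhds_limUnder ⟨_, (hG _ (hlt n)).tendsto_uniformRSSum (hlt n).le⟩
  refine ⟨F, fun n => ⟨_, fun m => uniformRSSum_mem hX f _ _ m, hFl n⟩, hFl, ?_⟩
  filter_upwards [hY, ae_all_iff.2 hFl] with ω ⟨I, ⟨G, hG, hGI⟩, hYI⟩ hω
  have hFG : ∀ n, F n ω = G (t - (n + 1 : ℕ)) := fun n =>
    tendsto_nhds_unique (hω n) ((hG _ (hlt n)).tendsto_uniformRSSum (hlt n).le)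
  have hbot : Tendsto (fun n : ℕ => t - ((n + 1 : ℕ) : ℝ)) atTop atBot := by
    refine tendsto_atBot_add_const_left _ t (tendsto_neg_atTop_atBot.comp ?_)
    exact tendsto_natCast_atTop_atTop.comp (tendsto_add_atTop_nat 1)
  simp_rw [hFG, hYI]
  exact (hGI.comp hbot).const_mul ν

/-- The covariance of an Ornstein-Uhlenbeck variable with an element `Z` of the Gaussian space is
the Ornstein-Uhlenbeck integral of the deterministic function `u ↦ Cov(X u, Z)`. -/
lemma covariance_improperIntegral_exp [IsProbabilityMeasure P] {M : Submodule ℝ (Ω → ℝ)}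
    (hM : IsCenteredGaussianSpace P M) {X : ℝ → Ω → ℝ} (hX : ∀ u, X u ∈ M)
    {α t ν : ℝ} (hα : 0 < α) {Y : Ω → ℝ}
    (hY : ∀ᵐ ω ∂P, ∃ I : ℝ,
      HasImproperRiemannStieltjesIntegral (fun u => Real.exp (-α * (t - u))) (fun u => X u ω) t I ∧
      Y ω = ν * I) :
    Y ∈ aeLimits P (aeLimits P M) ∧
    ∀ (Z : Ω → ℝ) (K : ℝ), Z ∈ aeLimits P (aeLimits P M) → Continuous (fun u => cov[X u, Z; P]) →
      (∀ u, |cov[X u, Z; P]| ≤ K * (1 + |u|)) →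
      cov[Y, Z; P] = ν * ∫ x, (cov[X t, Z; P] - cov[X (t - x), Z; P]) ∂(expMeasure α) := by
  obtain ⟨F, hFM, hFl, hFY⟩ := exists_approx_of_improperIntegral hX hY
  have hνF : ∀ n, ν • F n ∈ aeLimits P M := fun n => (aeLimits P M).smul_mem ν (hFM n)
  have hYM : Y ∈ aeLimits P (aeLimits P M) := ⟨fun n => ν • F n, hνF, hFY⟩
  refine ⟨hYM, fun Z K hZ hc hK => ?_⟩
  have hle1 := le_aeLimits P M
  have hle2 := le_aeLimits P (aeLimits P M)
  have hM2 := hM.aeLimits.aeLimits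
  have hXM : ∀ u, X u ∈ aeLimits P (aeLimits P M) := fun u => hle2 (hle1 (hX u))
  have hlim := hM2.tendsto_covariance (fun n => hle2 (hνF n)) hYM hZ hFY
  have hderiv : ∀ u, HasDerivAt (fun u => Real.exp (-α * (t - u)))
      (α * Real.exp (-α * (t - u))) u := by
    intro u
    have h1 : HasDerivAt (fun u : ℝ => -α * (t - u)) α u := by
      simpa using ((hasDerivAt_id u).const_sub t).const_mul (-α)
    simpa [mul_comm] using h1.exp
  have hcov : ∀ n, cov[ν • F n, Z; P] = ν * (Real.exp (-α * (t - t)) * cov[X t, Z; P]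
      - Real.exp (-α * (t - (t - (n + 1 : ℕ)))) * cov[X (t - (n + 1 : ℕ)), Z; P]
      - ∫ u in (t - (n + 1 : ℕ))..t, α * Real.exp (-α * (t - u)) * cov[X u, Z; P]) := by
    intro n
    rw [covariance_smul_left]
    congr 1
    have h1 := hM2.tendsto_covariance
      (fun m => uniformRSSum_mem hXM (fun u => Real.exp (-α * (t - u))) (t - (n + 1 : ℕ)) t m)
      (hle2 (hFM n)) hZ (hFl n)
    simp_rw [fun m => covariance_uniformRSSum hM2 hXM hZ (fun u => Real.exp (-α * (t - u)))
      (t - (n + 1 : ℕ)) t m] at h1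
    refine tendsto_nhds_unique h1 (tendsto_uniformRSSum_of_hasDerivAt ?_ hderiv (by fun_prop) hc)
    have : (0 : ℝ) ≤ (n + 1 : ℕ) := by positivity
    linarith
  simp_rw [hcov] at hlim
  have hbot : Tendsto (fun n : ℕ => t - ((n + 1 : ℕ) : ℝ)) atTop atBot := by
    refine tendsto_atBot_add_const_left _ t (tendsto_neg_atTop_atBot.comp ?_)
    exact tendsto_natCast_atTop_atTop.comp (tendsto_add_atTop_nat 1)
  exact tendsto_nhds_unique hlim
    (((tendsto_integral_by_parts_exp hα hc hK).comp hbot).const_mul ν)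

end OrnsteinUhlenbeck

section FractionalBrownianMotion

variable {Ω : Type*} [MeasurableSpace Ω] {P : Measure Ω}

namespace IsFBm

variable {h : ℝ} {X : ℝ → Ω → ℝ}

lemma memLp (hX : IsFBm P h X) (u : ℝ) : MemLp (X u) 2 P :=
  (hX.gaussian.hasGaussianLaw_eval u).memLp_two

lemma variance_eq (hX : IsFBm P h X) (h0 : 0 < h) (u : ℝ) : Var[X u; P] = |u| ^ (2 * h) := by
  rw [← covariance_self (hX.memLp u).aemeasurable, hX.cov_eq, sub_self, abs_zero,
    Real.zero_rpow (by positivity)]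
  ring

variable [IsProbabilityMeasure P]

lemma variance_sub (hX : IsFBm P h X) (h0 : 0 < h) (u v : ℝ) :
    Var[X u - X v; P] = |u - v| ^ (2 * h) := by
  rw [ProbabilityTheory.variance_sub (hX.memLp u) (hX.memLp v), hX.variance_eq h0,
    hX.variance_eq h0, hX.cov_eq]
  ring

lemma abs_covariance_sub_le (hX : IsFBm P h X) (h0 : 0 < h) {Z : Ω → ℝ} (hZ : MemLp Z 2 P)
    (u v : ℝ) : |cov[X u, Z; P] - cov[X v, Z; P]| ≤ |u - v| ^ h * √(Var[Z; P]) := by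
  rw [← covariance_sub_left (hX.memLp u) (hX.memLp v) hZ]
  refine (abs_covariance_le ((hX.memLp u).sub (hX.memLp v)) hZ).trans_eq ?_
  rw [hX.variance_sub h0, mul_comm 2 h, Real.rpow_mul (abs_nonneg _), Real.rpow_two,
    Real.sqrt_sq (Real.rpow_nonneg (abs_nonneg _) _)]

lemma continuous_covariance (hX : IsFBm P h X) (h0 : 0 < h) {Z : Ω → ℝ} (hZ : MemLp Z 2 P) :
    Continuous fun u => cov[X u, Z; P] := by
  refine continuous_iff_continuousAt.2 fun v => ?_
  rw [ContinuousAt, tendsto_iff_norm_sub_tendsto_zero]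
  refine squeeze_zero (fun _ => norm_nonneg _) (fun u => hX.abs_covariance_sub_le h0 hZ u v) ?_
  have hc : Continuous fun u : ℝ => |u - v| ^ h * √(Var[Z; P]) :=
    (Continuous.rpow_const (by fun_prop) fun _ => Or.inr h0.le).mul continuous_const
  have := hc.tendsto v
  simpa [Real.zero_rpow h0.ne'] using this

lemma abs_covariance_le_linear (hX : IsFBm P h X) (h0 : 0 < h) (h1 : h ≤ 1) {Z : Ω → ℝ}
    (hZ : MemLp Z 2 P) (u : ℝ) : |cov[X u, Z; P]| ≤ √(Var[Z; P]) * (1 + |u|) := by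
  refine (abs_covariance_le (hX.memLp u) hZ).trans ?_
  rw [hX.variance_eq h0, mul_comm 2 h, Real.rpow_mul (abs_nonneg _), Real.rpow_two,
    Real.sqrt_sq (Real.rpow_nonneg (abs_nonneg _) _), mul_comm]
  refine mul_le_mul_of_nonneg_left ?_ (Real.sqrt_nonneg _)
  calc |u| ^ h ≤ (1 + |u|) ^ h :=
        Real.rpow_le_rpow (abs_nonneg _) (by linarith) h0.le
    _ ≤ (1 + |u|) ^ (1 : ℝ) :=
        Real.rpow_le_rpow_of_exponent_le (by linarith [abs_nonneg u]) h1
    _ = 1 + |u| := Real.rpow_one _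

end IsFBm

/-- The cross-covariance of the bivariate Ornstein-Uhlenbeck process as a double expectation, under
exponential laws, of covariances of increments of the driving process. -/
theorem covariance_fOU [IsProbabilityMeasure P] {h α ν : Fin 2 → ℝ} {B Y : Fin 2 → ℝ → Ω → ℝ}
    (hh : ∀ i, 0 < h i ∧ h i ≤ 1) (hα : ∀ i, 0 < α i)
    (hB : IsBivariateFBm P h B) (hY : IsBivariateFOU P α ν B Y) (i j : Fin 2) (t t' : ℝ) :
    cov[Y i t, Y j t'; P] = ν i * ν j * ∫ y, ∫ x,
      ((cov[B i t, B j t'; P] - cov[B i t, B j (t' - y); P])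
        - (cov[B i (t - x), B j t'; P] - cov[B i (t - x), B j (t' - y); P]))
        ∂(expMeasure (α i)) ∂(expMeasure (α j)) := by
  have hM := isCenteredGaussianSpace_span hB.gaussian fun p => (hB.fBm p.1).centered p.2
  set M := Submodule.span ℝ (Set.range fun p : Fin 2 × ℝ => B p.1 p.2)
  have hBM : ∀ i u, B i u ∈ M := fun i u => Submodule.subset_span ⟨(i, u), rfl⟩
  obtain ⟨hYi, hci⟩ := covariance_improperIntegral_exp hM (hBM i) (hα i) (hY.eq_integral i t)
  obtain ⟨hYj, hcj⟩ := covariance_improperIntegral_exp hM (hBM j) (hα j) (hY.eq_integral j t')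
  have hM2 := hM.aeLimits.aeLimits
  have hle : M ≤ aeLimits P (aeLimits P M) := (le_aeLimits P M).trans (le_aeLimits P _)
  rw [covariance_comm, hcj _ _ hYi ((hB.fBm j).continuous_covariance (hh j).1 (hM2.memLp hYi))
    ((hB.fBm j).abs_covariance_le_linear (hh j).1 (hh j).2 (hM2.memLp hYi))]
  have key : ∀ y, cov[B j t', Y i t; P] - cov[B j (t' - y), Y i t; P] = ν i * ∫ x,
      ((cov[B i t, B j t'; P] - cov[B i t, B j (t' - y); P])
        - (cov[B i (t - x), B j t'; P] - cov[B i (t - x), B j (t' - y); P]))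
        ∂(expMeasure (α i)) := by
    intro y
    have hZ : B j t' - B j (t' - y) ∈ M := M.sub_mem (hBM j _) (hBM j _)
    rw [← covariance_sub_left (hM.memLp (hBM j _)) (hM.memLp (hBM j _)) (hM2.memLp hYi),
      covariance_comm, hci _ _ (hle hZ)
        ((hB.fBm i).continuous_covariance (hh i).1 (hM.memLp hZ))
        ((hB.fBm i).abs_covariance_le_linear (hh i).1 (hh i).2 (hM.memLp hZ))]
    simp_rw [fun u => covariance_sub_right (hM.memLp (hBM i u)) (hM.memLp (hBM j t'))
      (hM.memLp (hBM j (t' - y)))]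
  simp_rw [key]
  rw [integral_const_mul]
  ring

end FractionalBrownianMotion

/-! ### Taylor expansion under exponential laws -/

section Taylor

/-- Taylor's formula with a two-sided remainder bound, for a function given with all its
derivatives on the positive half-line. -/
lemma abs_sub_taylor_le (M : ℕ) {f : ℕ → ℝ → ℝ}
    (hd : ∀ n x, 0 < x → HasDerivAt (f n) (f (n + 1) x) x) {s z C : ℝ} (hz : |z| < s)
    (hC : ∀ w, |w - s| ≤ |z| → |f M w| ≤ C) :
    |f 0 (s + z) - ∑ n ∈ Finset.range M, f n s * (z ^ n / n.factorial)| ≤ C * |z| ^ M := by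
  induction M generalizing f z with
  | zero => simpa using hC (s + z) (by simp)
  | succ M ih =>
    have hC0 : 0 ≤ C := (abs_nonneg _).trans (hC s (by simp))
    set φ : ℝ → ℝ := fun w =>
      f 0 (s + w) - ∑ n ∈ Finset.range (M + 1), f n s * (w ^ n / n.factorial) with hφ
    have hder : ∀ w ∈ Set.Icc (-|z|) |z|, HasDerivWithinAt φ
        (f 1 (s + w) - ∑ n ∈ Finset.range M, f (n + 1) s * (w ^ n / n.factorial))
        (Set.Icc (-|z|) |z|) w := by
      intro w hw
      have hpos : 0 < s + w := by linarith [hw.1]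
      have h1 : HasDerivAt (fun w => f 0 (s + w)) (f 1 (s + w)) w := by
        simpa using (hd 0 (s + w) hpos).comp_const_add s w
      have h2 : HasDerivAt (fun w : ℝ => ∑ n ∈ Finset.range (M + 1), f n s * (w ^ n / n.factorial))
          (∑ n ∈ Finset.range M, f (n + 1) s * (w ^ n / n.factorial)) w := by
        simp_rw [Finset.sum_range_succ' _ M]
        have h3 : HasDerivAt (fun w : ℝ => ∑ n ∈ Finset.range M,
            f (n + 1) s * (w ^ (n + 1) / (n + 1).factorial))
            (∑ n ∈ Finset.range M, f (n + 1) s * (w ^ n / n.factorial)) w := by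
          refine HasDerivAt.fun_sum fun n _ => ?_
          have h4 := ((hasDerivAt_pow (n + 1) w).div_const ((n + 1).factorial : ℝ)).const_mul
            (f (n + 1) s)
          have h5 : f (n + 1) s * (((n + 1 : ℕ) : ℝ) * w ^ (n + 1 - 1) / (n + 1).factorial)
              = f (n + 1) s * (w ^ n / n.factorial) := by
            rw [Nat.factorial_succ, Nat.add_sub_cancel]
            have : (n.factorial : ℝ) ≠ 0 := by positivity
            push_cast
            field_simp
          rw [← h5]
          exact h4
        simpa using h3.add_const (f 0 s)
      exact (h1.sub h2).hasDerivWithinAt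
    have hbound : ∀ w ∈ Set.Icc (-|z|) |z|,
        ‖f 1 (s + w) - ∑ n ∈ Finset.range M, f (n + 1) s * (w ^ n / n.factorial)‖
          ≤ C * |z| ^ M := by
      intro w hw
      have hwz : |w| ≤ |z| := abs_le.2 hw
      refine (ih (f := fun n => f (n + 1)) (fun n x hx => hd (n + 1) x hx)
        (hwz.trans_lt hz) fun v hv => hC v (hv.trans hwz)).trans ?_
      gcongr
    have hφ0 : φ 0 = 0 := by
      simp only [hφ]
      rw [Finset.sum_range_succ']
      simp
    have := (convex_Icc (-|z|) |z|).norm_image_sub_le_of_norm_hasDerivWithin_le hder hbound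
      (x := 0) (y := z) ⟨by simp, by simp⟩ ⟨neg_abs_le z, le_abs_self z⟩
    rw [hφ0, sub_zero, sub_zero] at this
    rw [pow_succ, ← mul_assoc]
    exact this

/-- A Taylor remainder bound valid for increments `z` of every size: for `|z| ≤ s / 2` it is
Taylor's formula, while for `|z| > s / 2` both terms are polynomially bounded and the negative power
of `s` is compensated by a power of `|z|`. -/
lemma exists_abs_sub_taylor_le {c : ℝ → ℝ} {f : ℕ → ℝ → ℝ} {M : ℕ} {A₀ A β : ℝ} {a : ℕ → ℝ}
    (hf0 : ∀ x, 0 < x → f 0 x = c x)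
    (hd : ∀ n x, 0 < x → HasDerivAt (f n) (f (n + 1) x) x)
    (hc : ∀ x, |c x| ≤ A₀ * (1 + |x|) ^ 2)
    (ha : ∀ n x, 1 ≤ x → |f n x| ≤ a n * x ^ 2)
    (hA : ∀ x, 0 < x → |f (M + 1) x| ≤ A * x ^ β) (hβ : β ≤ 0) (hβM : -β ≤ M + 1) :
    ∃ (C : ℝ) (p : ℕ), ∀ s z : ℝ, 1 ≤ s →
      |c (s + z) - ∑ n ∈ Finset.range (M + 1), f n s * (z ^ n / n.factorial)|
        ≤ C * s ^ β * (1 + |z|) ^ p := by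
  have hA₀0 : 0 ≤ A₀ := by simpa using (abs_nonneg _).trans (hc 0)
  have ha0 : ∀ n, 0 ≤ a n := fun n => by simpa using (abs_nonneg _).trans (ha n 1 le_rfl)
  have hA0 : 0 ≤ A := by simpa using (abs_nonneg _).trans (hA 1 one_pos)
  set C₁ : ℝ := A * (1 / 2) ^ β with hC₁
  set C₂ : ℝ := 9 * A₀ + ∑ n ∈ Finset.range (M + 1), 4 * a n with hC₂
  have hC₁0 : 0 ≤ C₁ := by positivity
  have hC₂0 : 0 ≤ C₂ := by
    have : 0 ≤ ∑ n ∈ Finset.range (M + 1), 4 * a n :=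
      Finset.sum_nonneg fun n _ => mul_nonneg (by norm_num) (ha0 n)
    positivity
  refine ⟨C₁ + C₂ * 2 ^ (M + 1), 2 * M + 3, fun s z hs => ?_⟩
  have hs0 : 0 < s := by linarith
  have hsβ : 0 < s ^ β := Real.rpow_pos_of_pos hs0 β
  have hz1 : 1 ≤ 1 + |z| := by linarith [abs_nonneg z]
  rcases le_or_gt |z| (s / 2) with hzs | hzs
  · have hpos : 0 < s + z := by linarith [neg_abs_le z]
    rw [← hf0 _ hpos]
    have h1 := abs_sub_taylor_le (M + 1) hd (s := s) (z := z) (C := C₁ * s ^ β) (by linarith)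
      (fun w hw => by
        have hw' : s / 2 ≤ w := by linarith [(abs_le.1 (hw.trans hzs)).1]
        refine (hA w (by linarith)).trans ?_
        have h2 : w ^ β ≤ (s / 2) ^ β := Real.rpow_le_rpow_of_nonpos (by linarith) hw' hβ
        rw [show s / 2 = 1 / 2 * s by ring, Real.mul_rpow (by norm_num) hs0.le] at h2
        calc A * w ^ β ≤ A * ((1 / 2) ^ β * s ^ β) := mul_le_mul_of_nonneg_left h2 hA0
          _ = C₁ * s ^ β := by rw [hC₁]; ring)
    refine h1.trans ?_
    have h3 : |z| ^ (M + 1) ≤ (1 + |z|) ^ (2 * M + 3) :=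
      (pow_le_pow_left₀ (abs_nonneg z) (by linarith) _).trans
        (pow_le_pow_right₀ hz1 (by omega))
    have h4 : C₁ ≤ C₁ + C₂ * 2 ^ (M + 1) := by
      have : 0 ≤ C₂ * 2 ^ (M + 1) := by positivity
      linarith
    gcongr
  · have h1 : |c (s + z)| ≤ 9 * A₀ * (1 + |z|) ^ (M + 2) := by
      have h2 : 1 + |s + z| ≤ 3 * (1 + |z|) := by
        have := abs_add_le s z
        rw [abs_of_pos hs0] at this
        linarith
      calc |c (s + z)| ≤ A₀ * (1 + |s + z|) ^ 2 := hc _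
        _ ≤ A₀ * (3 * (1 + |z|)) ^ 2 := by gcongr
        _ = 9 * A₀ * (1 + |z|) ^ 2 := by ring
        _ ≤ 9 * A₀ * (1 + |z|) ^ (M + 2) := by
          gcongr
          omega
    have h2 : ∀ n ∈ Finset.range (M + 1),
        |f n s * (z ^ n / n.factorial)| ≤ 4 * a n * (1 + |z|) ^ (M + 2) := by
      intro n hn
      have hn' : n + 2 ≤ M + 2 := by have := Finset.mem_range.1 hn; omega
      have hfac : (1 : ℝ) ≤ n.factorial := by exact_mod_cast n.factorial_pos
      rw [abs_mul, abs_div, abs_pow, Nat.abs_cast]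
      calc |f n s| * (|z| ^ n / n.factorial) ≤ (a n * s ^ 2) * (|z| ^ n / 1) := by
            gcongr
            · exact mul_nonneg (ha0 n) (by positivity)
            · exact ha n s hs
        _ ≤ (a n * (2 * (1 + |z|)) ^ 2) * ((1 + |z|) ^ n / 1) := by
            have := ha0 n
            gcongr
            · linarith
            · linarith
        _ = 4 * a n * (1 + |z|) ^ (n + 2) := by ring
        _ ≤ 4 * a n * (1 + |z|) ^ (M + 2) := by
            have := ha0 n
            gcongr
    have h3 : |c (s + z) - ∑ n ∈ Finset.range (M + 1), f n s * (z ^ n / n.factorial)|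
        ≤ C₂ * (1 + |z|) ^ (M + 2) := by
      refine (abs_sub _ _).trans ?_
      rw [hC₂, add_mul, Finset.sum_mul]
      exact add_le_add h1 ((Finset.abs_sum_le_sum_abs _ _).trans (Finset.sum_le_sum h2))
    have h4 : 1 ≤ s ^ β * (2 * (1 + |z|)) ^ (M + 1) := by
      have h5 : (2 * (1 + |z|)) ^ β ≤ s ^ β := Real.rpow_le_rpow_of_nonpos hs0 (by linarith) hβ
      have h6 : (1 : ℝ) ≤ (2 * (1 + |z|)) ^ (β + (M + 1 : ℕ)) :=
        Real.one_le_rpow (by linarith) (by push_cast; linarith)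
      rw [Real.rpow_add (by linarith), Real.rpow_natCast] at h6
      exact h6.trans (mul_le_mul_of_nonneg_right h5 (by positivity))
    calc _ ≤ C₂ * (1 + |z|) ^ (M + 2) := h3
      _ ≤ C₂ * (1 + |z|) ^ (M + 2) * (s ^ β * (2 * (1 + |z|)) ^ (M + 1)) :=
          le_mul_of_one_le_right (by positivity) h4
      _ = (C₂ * 2 ^ (M + 1)) * s ^ β * (1 + |z|) ^ (2 * M + 3) := by
          rw [mul_pow, show 2 * M + 3 = (M + 2) + (M + 1) by ring, pow_add (1 + |z|)]; ring
      _ ≤ (C₁ + C₂ * 2 ^ (M + 1)) * s ^ β * (1 + |z|) ^ (2 * M + 3) := by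
          gcongr
          linarith

end Taylor

section Moments

variable {a b : ℝ}

lemma integrable_add_neg_pow_expMeasure (ha : 0 < a) (hb : 0 < b) (n : ℕ) :
    Integrable (fun z : ℝ × ℝ => (z.2 + -z.1) ^ n / (n.factorial : ℝ))
      ((expMeasure b).prod (expMeasure a)) := by
  have := isProbabilityMeasure_expMeasure ha
  have := isProbabilityMeasure_expMeasure hb
  simp_rw [add_pow]
  refine (integrable_finsetSum _ fun k _ => ?_).div_const _
  have h := ((integrable_pow_expMeasure hb (n - k)).const_mul ((-1) ^ (n - k))).mul_prod
    (integrable_pow_expMeasure ha k)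
  refine (h.mul_const ((n.choose k : ℝ))).congr (ae_of_all _ fun z => ?_)
  simp only
  rw [neg_pow z.1]
  ring

/-- The normalized moments of the difference of two independent exponential variables. -/
lemma integral_add_neg_pow_expMeasure (ha : 0 < a) (hb : 0 < b) (n : ℕ) :
    ∫ z : ℝ × ℝ, (z.2 + -z.1) ^ n / (n.factorial : ℝ) ∂((expMeasure b).prod (expMeasure a))
      = ∑ k ∈ Finset.range (n + 1), (1 / a) ^ k * (-(1 / b)) ^ (n - k) := by
  have := isProbabilityMeasure_expMeasure ha
  have := isProbabilityMeasure_expMeasure hb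
  have e : ∀ z : ℝ × ℝ, (z.2 + -z.1) ^ n / (n.factorial : ℝ)
      = ∑ k ∈ Finset.range (n + 1),
        ((-1) ^ (n - k) * (z.1 ^ (n - k) / (n - k).factorial)) * (z.2 ^ k / k.factorial) := by
    intro z
    rw [add_pow, Finset.sum_div]
    refine Finset.sum_congr rfl fun k hk => ?_
    have hk' : k ≤ n := Nat.lt_succ_iff.1 (Finset.mem_range.1 hk)
    rw [Nat.cast_choose ℝ hk', neg_pow z.1]
    have : (n.factorial : ℝ) ≠ 0 := by positivity
    field_simp
  simp_rw [e]
  rw [integral_finsetSum _ fun k _ => Integrable.mul_prod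
    (((integrable_pow_expMeasure hb (n - k)).div_const _).const_mul _)
    ((integrable_pow_expMeasure ha k).div_const _)]
  refine Finset.sum_congr rfl fun k _ => ?_
  rw [integral_prod_mul (fun y : ℝ => (-1) ^ (n - k) * (y ^ (n - k) / (n - k).factorial))
    (fun x : ℝ => x ^ k / k.factorial), integral_const_mul, integral_div, integral_div,
    integral_pow_expMeasure hb, integral_pow_expMeasure ha, neg_pow (1 / b), one_div_pow,
    one_div_pow]
  have h1 : (k.factorial : ℝ) ≠ 0 := by positivity
  have h2 : ((n - k).factorial : ℝ) ≠ 0 := by positivity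
  field_simp

lemma integral_fst_pow_expMeasure (ha : 0 < a) (hb : 0 < b) (n : ℕ) :
    ∫ z : ℝ × ℝ, (-z.1) ^ n / (n.factorial : ℝ) ∂((expMeasure b).prod (expMeasure a))
      = (-(1 / b)) ^ n := by
  have := isProbabilityMeasure_expMeasure ha
  have := isProbabilityMeasure_expMeasure hb
  have h := integral_prod_mul (μ := expMeasure b) (ν := expMeasure a)
    (fun y : ℝ => (-y) ^ n / (n.factorial : ℝ)) (fun _ => (1 : ℝ))
  simp only [mul_one, integral_const, probReal_univ, smul_eq_mul] at h
  have e : (fun y : ℝ => (-y) ^ n) = fun y => (-1) ^ n * y ^ n := funext fun y => neg_pow y n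
  rw [h, integral_div, e, integral_const_mul, integral_pow_expMeasure hb]
  have h1 : (n.factorial : ℝ) ≠ 0 := by positivity
  rw [neg_pow (1 / b), one_div_pow]
  field_simp

lemma integral_snd_pow_expMeasure (ha : 0 < a) (hb : 0 < b) (n : ℕ) :
    ∫ z : ℝ × ℝ, z.2 ^ n / (n.factorial : ℝ) ∂((expMeasure b).prod (expMeasure a))
      = (1 / a) ^ n := by
  have := isProbabilityMeasure_expMeasure ha
  have := isProbabilityMeasure_expMeasure hb
  have h := integral_prod_mul (μ := expMeasure b) (ν := expMeasure a) (fun _ => (1 : ℝ))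
    (fun y : ℝ => y ^ n / (n.factorial : ℝ))
  simp only [mul_one, one_mul, integral_const, probReal_univ, smul_eq_mul] at h
  rw [h, integral_div, integral_pow_expMeasure ha]
  have h1 : (n.factorial : ℝ) ≠ 0 := by positivity
  rw [one_div_pow]
  field_simp

lemma integrable_fst_pow_expMeasure (ha : 0 < a) (hb : 0 < b) (n : ℕ) :
    Integrable (fun z : ℝ × ℝ => (-z.1) ^ n / (n.factorial : ℝ))
      ((expMeasure b).prod (expMeasure a)) := by
  have := isProbabilityMeasure_expMeasure ha
  have := isProbabilityMeasure_expMeasure hb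
  have h := (((integrable_pow_expMeasure hb n).const_mul ((-1) ^ n)).div_const
    (n.factorial : ℝ)).mul_prod (integrable_const (μ := expMeasure a) (1 : ℝ))
  refine h.congr (ae_of_all _ fun z => ?_)
  simp only [mul_one]
  rw [neg_pow z.1]

lemma integrable_snd_pow_expMeasure (ha : 0 < a) (hb : 0 < b) (n : ℕ) :
    Integrable (fun z : ℝ × ℝ => z.2 ^ n / (n.factorial : ℝ))
      ((expMeasure b).prod (expMeasure a)) := by
  have := isProbabilityMeasure_expMeasure ha
  have := isProbabilityMeasure_expMeasure hb
  have h := (integrable_const (μ := expMeasure b) (1 : ℝ)).mul_prod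
    ((integrable_pow_expMeasure ha n).div_const (n.factorial : ℝ))
  simpa using h

/-- The expectation of the double increment of `w ↦ w ^ n / n!` vanishes for `n ≤ 1`; from `n = 2`
on, it is a geometric sum. -/
lemma integral_increment_pow_expMeasure (ha : 0 < a) (hb : 0 < b) (n : ℕ) :
    ∫ z : ℝ × ℝ, (z.2 ^ n / (n.factorial : ℝ) - 0 ^ n / (n.factorial : ℝ)
        + (-z.1) ^ n / (n.factorial : ℝ) - (z.2 + -z.1) ^ n / (n.factorial : ℝ))
        ∂((expMeasure b).prod (expMeasure a))
      = if n < 2 then 0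
        else ((-1) ^ (n - 2) / b ^ (n - 2 + 1) + 1 / a ^ (n - 2 + 1)) / (a + b) := by
  have := isProbabilityMeasure_expMeasure ha
  have := isProbabilityMeasure_expMeasure hb
  have h1 := integrable_snd_pow_expMeasure ha hb n
  have h2 := integrable_fst_pow_expMeasure ha hb n
  have h3 := integrable_add_neg_pow_expMeasure ha hb n
  have h0 : Integrable (fun _ : ℝ × ℝ => (0 : ℝ) ^ n / (n.factorial : ℝ))
    ((expMeasure b).prod (expMeasure a)) := integrable_const _
  have h4 := (h1.sub h0).add h2
  rw [integral_sub (f := fun z : ℝ × ℝ => z.2 ^ n / (n.factorial : ℝ) - 0 ^ n / (n.factorial : ℝ)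
        + (-z.1) ^ n / (n.factorial : ℝ)) h4 h3,
    integral_add (f := fun z : ℝ × ℝ => z.2 ^ n / (n.factorial : ℝ) - 0 ^ n / (n.factorial : ℝ))
      (h1.sub h0) h2, integral_sub h1 h0, integral_const, integral_snd_pow_expMeasure ha hb,
    integral_fst_pow_expMeasure ha hb, integral_add_neg_pow_expMeasure ha hb]
  rcases n with _ | _ | n
  · simp
  · simp [Finset.sum_range_succ]
    ring
  · have hab : 1 / a - -(1 / b) ≠ 0 := by
      have : 0 < 1 / a + 1 / b := by positivity
      linarith
    have hg : (∑ k ∈ Finset.range (n + 2 + 1), (1 / a) ^ k * (-(1 / b)) ^ (n + 2 - k))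
        = ((1 / a) ^ (n + 3) - (-(1 / b)) ^ (n + 3)) / (1 / a - -(1 / b)) := by
      rw [eq_div_iff hab]
      have := (Commute.all (1 / a) (-(1 / b))).geom_sum₂_mul (n + 3)
      simpa using this
    rw [show n + 1 + 1 = n + 2 from rfl, hg, if_neg (by omega), Nat.add_sub_cancel]
    simp only [neg_pow (1 / b), one_div_pow, probReal_univ, smul_eq_mul]
    have hab' : a + b ≠ 0 := by positivity
    have h5 : 1 / a - -(1 / b) = (a + b) / (a * b) := by field_simp; ring
    rw [h5]
    simp only [pow_succ]
    field_simp
    ring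

end Moments

section CovarianceAsymptotics

/-- The asymptotic expansion of the expected double increment of `c` under exponential laws: insert
the Taylor polynomial of `c` at `s`, whose terms of degree at most one do not contribute. -/
lemma isBigO_integral_increment {c : ℝ → ℝ} {f : ℕ → ℝ → ℝ} {N : ℕ} {A₀ A β a b : ℝ} {d : ℕ → ℝ}
    (ha : 0 < a) (hb : 0 < b) (hcm : Measurable c)
    (hf0 : ∀ x, 0 < x → f 0 x = c x)
    (hd : ∀ n x, 0 < x → HasDerivAt (f n) (f (n + 1) x) x)
    (hc : ∀ x, |c x| ≤ A₀ * (1 + |x|) ^ 2)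
    (hfd : ∀ n x, 1 ≤ x → |f n x| ≤ d n * x ^ 2)
    (hA : ∀ x, 0 < x → |f (N + 3) x| ≤ A * x ^ β) (hβ : β ≤ 0) (hβN : -β ≤ N + 3) :
    (fun s : ℝ => (∫ y, ∫ x, (c (s + x) - c (s + 0) + c (s + -y) - c (s + (x + -y)))
        ∂(expMeasure a) ∂(expMeasure b))
      - ∑ n ∈ Finset.range (N + 1),
        f (n + 2) s * (((-1) ^ n / b ^ (n + 1) + 1 / a ^ (n + 1)) / (a + b)))
      =O[atTop] fun s => s ^ β := by
  have hpa := isProbabilityMeasure_expMeasure ha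
  have hpb := isProbabilityMeasure_expMeasure hb
  obtain ⟨C, p, hC⟩ := exists_abs_sub_taylor_le (M := N + 2) hf0 hd hc hfd hA hβ
    (by push_cast; linarith)
  have hC0 : 0 ≤ C := by simpa using (abs_nonneg _).trans (hC 1 0 le_rfl)
  have hA₀0 : 0 ≤ A₀ := by simpa using (abs_nonneg _).trans (hc 0)
  set π := (expMeasure b).prod (expMeasure a) with hπ
  -- all integrability claims follow from domination by a product of polynomials
  have hdom : ∀ q : ℕ, Integrable (fun z : ℝ × ℝ => (1 + |z.1|) ^ q * (1 + |z.2|) ^ q) π := fun q =>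
    (integrable_one_add_abs_pow_expMeasure hb q).mul_prod
      (integrable_one_add_abs_pow_expMeasure ha q)
  have hle : ∀ (w : ℝ) (z : ℝ × ℝ), w ∈ ({z.2, 0, -z.1, z.2 + -z.1} : Set ℝ) →
      1 + |w| ≤ (1 + |z.1|) * (1 + |z.2|) := by
    rintro w ⟨y, x⟩ hw
    have h1 := abs_nonneg y
    have h2 := abs_nonneg x
    have h3 := mul_nonneg h1 h2
    have h4 : |x + -y| ≤ |x| + |y| := by simpa using abs_add_le x (-y)
    simp only [Set.mem_insert_iff, Set.mem_singleton_iff] at hw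
    rcases hw with rfl | rfl | rfl | rfl
    · nlinarith
    · simp only [abs_zero]; nlinarith
    · simp only [abs_neg]; nlinarith
    · simp only; nlinarith
  have hint : ∀ (s : ℝ) (w : ℝ × ℝ → ℝ), Measurable w →
      (∀ z, w z ∈ ({z.2, 0, -z.1, z.2 + -z.1} : Set ℝ)) → Integrable (fun z => c (s + w z)) π := by
    intro s w hw hwz
    refine Integrable.mono' ((hdom 2).const_mul (A₀ * (1 + |s|) ^ 2))
      (hcm.comp (hw.const_add s)).aestronglyMeasurable (ae_of_all _ fun z => ?_)
    rw [Real.norm_eq_abs, ← mul_pow, mul_assoc, ← mul_pow]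
    refine (hc _).trans ?_
    have h1 := hle _ z (hwz z)
    have h2 : 1 + |s + w z| ≤ (1 + |s|) * (1 + |w z|) := by
      have := abs_add_le s (w z)
      nlinarith [mul_nonneg (abs_nonneg s) (abs_nonneg (w z))]
    have h3 : 1 + |s + w z| ≤ (1 + |s|) * ((1 + |z.1|) * (1 + |z.2|)) :=
      h2.trans (mul_le_mul_of_nonneg_left h1 (by positivity))
    gcongr
  have hintD : ∀ s : ℝ, Integrable (fun z : ℝ × ℝ =>
      c (s + z.2) - c (s + 0) + c (s + -z.1) - c (s + (z.2 + -z.1))) π := fun s =>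
    (((hint s (fun z => z.2) (by fun_prop) (by simp)).sub
      (hint s (fun _ => 0) (by fun_prop) (by simp))).add
      (hint s (fun z => -z.1) (by fun_prop) (by simp))).sub
      (hint s (fun z => z.2 + -z.1) (by fun_prop) (by simp))
  -- `T s` is the Taylor polynomial of `c` at `s`, in the increment `w`
  set T : ℝ → ℝ → ℝ := fun s w => ∑ n ∈ Finset.range (N + 2 + 1), f n s * (w ^ n / n.factorial)
    with hT
  have hTD : ∀ s (z : ℝ × ℝ), T s z.2 - T s 0 + T s (-z.1) - T s (z.2 + -z.1)
      = ∑ n ∈ Finset.range (N + 2 + 1), f n s *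
        (z.2 ^ n / (n.factorial : ℝ) - 0 ^ n / (n.factorial : ℝ)
        + (-z.1) ^ n / (n.factorial : ℝ) - (z.2 + -z.1) ^ n / (n.factorial : ℝ)) := by
    intro s z
    simp only [hT]
    rw [← Finset.sum_sub_distrib, ← Finset.sum_add_distrib, ← Finset.sum_sub_distrib]
    exact Finset.sum_congr rfl fun n _ => by ring
  have hintn : ∀ n : ℕ, Integrable (fun z : ℝ × ℝ =>
      (z.2 ^ n / (n.factorial : ℝ) - 0 ^ n / (n.factorial : ℝ)
        + (-z.1) ^ n / (n.factorial : ℝ) - (z.2 + -z.1) ^ n / (n.factorial : ℝ))) π := fun n =>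
    (((integrable_snd_pow_expMeasure ha hb n).sub (integrable_const _)).add
      (integrable_fst_pow_expMeasure ha hb n)).sub (integrable_add_neg_pow_expMeasure ha hb n)
  have hintT : ∀ s, Integrable (fun z : ℝ × ℝ =>
      T s z.2 - T s 0 + T s (-z.1) - T s (z.2 + -z.1)) π := by
    intro s
    simp_rw [hTD]
    exact integrable_finsetSum _ fun n _ => (hintn n).const_mul _
  have hTint : ∀ s, ∫ z : ℝ × ℝ, (T s z.2 - T s 0 + T s (-z.1) - T s (z.2 + -z.1)) ∂π
      = ∑ n ∈ Finset.range (N + 1),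
        f (n + 2) s * (((-1) ^ n / b ^ (n + 1) + 1 / a ^ (n + 1)) / (a + b)) := by
    intro s
    simp_rw [hTD]
    rw [integral_finsetSum _ fun n _ => (hintn n).const_mul _]
    simp_rw [integral_const_mul, hπ, integral_increment_pow_expMeasure ha hb]
    rw [show N + 2 + 1 = N + 1 + 1 + 1 by ring, Finset.sum_range_succ', Finset.sum_range_succ']
    simp
  refine IsBigO.of_bound (4 * C * ∫ z : ℝ × ℝ, (1 + |z.1|) ^ p * (1 + |z.2|) ^ p ∂π) ?_
  filter_upwards [eventually_ge_atTop 1] with s hs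
  have hsβ : 0 < s ^ β := Real.rpow_pos_of_pos (by linarith) β
  have hfub := integral_prod _ (hintD s)
  simp only at hfub
  rw [← hTint, ← hfub, ← integral_sub (hintD s) (hintT s), Real.norm_of_nonneg hsβ.le]
  refine (norm_integral_le_of_norm_le ((hdom p).const_mul (4 * C * s ^ β))
    (ae_of_all _ fun z => ?_)).trans_eq (by rw [integral_const_mul]; ring)
  have hR : ∀ w, w ∈ ({z.2, 0, -z.1, z.2 + -z.1} : Set ℝ) →
      |c (s + w) - T s w| ≤ C * s ^ β * ((1 + |z.1|) ^ p * (1 + |z.2|) ^ p) := by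
    intro w hw
    refine (hC s w hs).trans ?_
    rw [← mul_pow]
    have h1 := hle w z hw
    gcongr
  have h1 := abs_le.1 (hR z.2 (by simp))
  have h2 := abs_le.1 (hR 0 (by simp))
  have h3 := abs_le.1 (hR (-z.1) (by simp))
  have h4 := abs_le.1 (hR (z.2 + -z.1) (by simp))
  rw [Real.norm_eq_abs, abs_le]
  constructor <;> linarith [h1.1, h1.2, h2.1, h2.2, h3.1, h3.2, h4.1, h4.2]

end CovarianceAsymptotics

/-! ### Covariance kernels and the asymptotic expansions -/

section Kernels

/-- The function `c` such that `Cov(B i u, B j v) = c v + c (-u) - c (v - u)` when `H ≠ 1`, with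
`η` standing for `η i j`. It is determined only up to a linear function. -/
noncomputable def powerKernel (H ρ η x : ℝ) : ℝ := (ρ - pmSign x * η) * |x| ^ H / 2

/-- The function `c` such that `Cov(B i u, B j v) = c v + c (-u) - c (v - u)` when `H = 1`, with
`η` standing for `η i j`. It is determined only up to a linear function. -/
noncomputable def logKernel (ρ η x : ℝ) : ℝ := (ρ * |x| + η * (x * Real.log |x|)) / 2

/-- The `n`-th derivative of `powerKernel H ρ η` on the positive half-line. -/
noncomputable def powerKernelDeriv (H ρ η : ℝ) (n : ℕ) (x : ℝ) : ℝ :=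
  (ρ - η) / 2 * (∏ k ∈ Finset.range n, (H - k)) * x ^ (H - n)

/-- The `n`-th derivative of `logKernel ρ η` on the positive half-line. -/
noncomputable def logKernelDeriv (ρ η : ℝ) : ℕ → ℝ → ℝ
  | 0, x => (ρ * x + η * (x * Real.log x)) / 2
  | 1, x => (ρ + η * (Real.log x + 1)) / 2
  | n + 2, x => η / 2 * (∏ k ∈ Finset.range n, (-(k : ℝ) - 1)) * x ^ (-1 - (n : ℝ))

lemma pmSign_of_nonneg {x : ℝ} (hx : 0 ≤ x) : pmSign x = 1 := if_pos hx

lemma pmSign_of_neg {x : ℝ} (hx : x < 0) : pmSign x = -1 := if_neg hx.not_ge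

lemma abs_pmSign (x : ℝ) : |pmSign x| = 1 := by
  unfold pmSign; split_ifs <;> simp

lemma measurable_pmSign : Measurable pmSign :=
  Measurable.ite measurableSet_Ici measurable_const measurable_const

/-- The convention `pmSign 0 = 1` is immaterial as soon as `pmSign x` multiplies `|x| ^ H`. -/
lemma pmSign_neg_mul_abs_rpow {H : ℝ} (hH : 0 < H) (x : ℝ) :
    pmSign (-x) * |x| ^ H = -(pmSign x * |x| ^ H) := by
  rcases lt_trichotomy x 0 with hx | rfl | hx
  · rw [pmSign_of_neg hx, pmSign_of_nonneg (by linarith)]; ring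
  · simp [Real.zero_rpow hH.ne']
  · rw [pmSign_of_nonneg hx.le, pmSign_of_neg (by linarith)]; ring

lemma measurable_powerKernel (H ρ η : ℝ) : Measurable (powerKernel H ρ η) := by
  have := measurable_pmSign
  unfold powerKernel
  fun_prop

lemma measurable_logKernel (ρ η : ℝ) : Measurable (logKernel ρ η) := by
  unfold logKernel
  fun_prop

lemma powerKernelDeriv_zero (H ρ η : ℝ) {x : ℝ} (hx : 0 < x) :
    powerKernelDeriv H ρ η 0 x = powerKernel H ρ η x := by
  simp only [powerKernelDeriv, powerKernel, pmSign_of_nonneg hx.le, abs_of_pos hx,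
    Finset.range_zero, Finset.prod_empty, Nat.cast_zero, sub_zero]
  ring

lemma logKernelDeriv_zero (ρ η : ℝ) {x : ℝ} (hx : 0 < x) :
    logKernelDeriv ρ η 0 x = logKernel ρ η x := by
  simp only [logKernelDeriv, logKernel, abs_of_pos hx]

lemma hasDerivAt_powerKernelDeriv (H ρ η : ℝ) (n : ℕ) {x : ℝ} (hx : 0 < x) :
    HasDerivAt (powerKernelDeriv H ρ η n) (powerKernelDeriv H ρ η (n + 1) x) x := by
  have h := (Real.hasDerivAt_rpow_const (x := x) (p := H - n) (Or.inl hx.ne')).const_mul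
    ((ρ - η) / 2 * (∏ k ∈ Finset.range n, (H - k)))
  have e : powerKernelDeriv H ρ η (n + 1) x
      = (ρ - η) / 2 * (∏ k ∈ Finset.range n, (H - k)) * ((H - n) * x ^ (H - n - 1)) := by
    rw [powerKernelDeriv, Finset.prod_range_succ, show H - ((n + 1 : ℕ) : ℝ) = H - n - 1 by
      push_cast; ring]
    ring
  rw [e]
  exact h

lemma hasDerivAt_logKernelDeriv (ρ η : ℝ) (n : ℕ) {x : ℝ} (hx : 0 < x) :
    HasDerivAt (logKernelDeriv ρ η n) (logKernelDeriv ρ η (n + 1) x) x := by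
  rcases n with _ | _ | n
  · have h1 := (((hasDerivAt_id x).const_mul ρ).add
      (((hasDerivAt_id x).mul (Real.hasDerivAt_log hx.ne')).const_mul η)).div_const 2
    have e : logKernelDeriv ρ η (0 + 1) x
        = (ρ * 1 + η * (1 * Real.log x + id x * x⁻¹)) / 2 := by
      simp [logKernelDeriv, hx.ne']
    rw [e]
    exact h1
  · have h1 := ((((Real.hasDerivAt_log hx.ne').add_const 1).const_mul η).const_add ρ).div_const 2
    have e : logKernelDeriv ρ η (0 + 1 + 1) x = η * x⁻¹ / 2 := by
      simp only [logKernelDeriv, Finset.range_zero, Finset.prod_empty, Nat.cast_zero, sub_zero,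
        Real.rpow_neg_one]
      ring
    rw [e]
    exact h1
  · have h := (Real.hasDerivAt_rpow_const (x := x) (p := -1 - (n : ℝ)) (Or.inl hx.ne')).const_mul
      (η / 2 * (∏ k ∈ Finset.range n, (-(k : ℝ) - 1)))
    have e : logKernelDeriv ρ η (n + 1 + 1 + 1) x
        = η / 2 * (∏ k ∈ Finset.range n, (-(k : ℝ) - 1))
          * ((-1 - (n : ℝ)) * x ^ (-1 - (n : ℝ) - 1)) := by
      simp only [logKernelDeriv, Finset.prod_range_succ]
      rw [show -1 - ((n + 1 : ℕ) : ℝ) = -1 - n - 1 by push_cast; ring]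
      ring
    rw [e]
    exact h

lemma abs_powerKernel_le {H : ℝ} (hH : 0 < H) (hH2 : H ≤ 2) (ρ η x : ℝ) :
    |powerKernel H ρ η x| ≤ (|ρ| + |η|) / 2 * (1 + |x|) ^ 2 := by
  have h1 : |x| ^ H ≤ (1 + |x|) ^ 2 := by
    rw [← Real.rpow_two]
    exact (Real.rpow_le_rpow (abs_nonneg _) (by linarith) hH.le).trans
      (Real.rpow_le_rpow_of_exponent_le (by linarith [abs_nonneg x]) hH2)
  have h2 : |ρ - pmSign x * η| ≤ |ρ| + |η| := by
    refine (abs_sub _ _).trans ?_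
    rw [abs_mul, abs_pmSign, one_mul]
  have h3 : 0 ≤ |x| ^ H := Real.rpow_nonneg (abs_nonneg _) _
  rw [powerKernel, abs_div, abs_mul, abs_of_nonneg h3, abs_two, div_mul_eq_mul_div]
  gcongr

lemma abs_self_mul_log_abs_le (x : ℝ) : abs (x * Real.log |x|) ≤ (1 + |x|) ^ 2 := by
  have h0 := abs_nonneg x
  rcases le_or_gt |x| 1 with h1 | h1
  · rcases h0.eq_or_lt with h2 | h2
    · rw [← h2]; simp
    · have h3 := Real.abs_log_mul_self_lt _ h2 h1
      rw [abs_mul, abs_abs] at h3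
      rw [abs_mul]
      nlinarith
  · have h2 := Real.log_nonneg h1.le
    have h3 := Real.log_le_sub_one_of_pos (by linarith : 0 < |x|)
    rw [abs_mul, abs_of_nonneg h2]
    nlinarith

lemma abs_logKernel_le (ρ η x : ℝ) :
    |logKernel ρ η x| ≤ (|ρ| + |η|) / 2 * (1 + |x|) ^ 2 := by
  have h1 : abs (ρ * |x|) ≤ |ρ| * (1 + |x|) ^ 2 := by
    rw [abs_mul, abs_abs]
    have := abs_nonneg x
    exact mul_le_mul_of_nonneg_left (by nlinarith) (abs_nonneg _)
  have h2 : abs (η * (x * Real.log |x|)) ≤ |η| * (1 + |x|) ^ 2 := by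
    rw [abs_mul]
    exact mul_le_mul_of_nonneg_left (abs_self_mul_log_abs_le x) (abs_nonneg _)
  rw [logKernel, abs_div, abs_two]
  have := abs_add_le (ρ * |x|) (η * (x * Real.log |x|))
  linarith

lemma abs_powerKernelDeriv_le {H : ℝ} (hH2 : H ≤ 2) (ρ η : ℝ) (n : ℕ) {x : ℝ} (hx : 1 ≤ x) :
    |powerKernelDeriv H ρ η n x|
      ≤ |(ρ - η) / 2 * ∏ k ∈ Finset.range n, (H - k)| * x ^ 2 := by
  rw [powerKernelDeriv, abs_mul, abs_of_nonneg (Real.rpow_nonneg (by linarith) _)]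
  refine mul_le_mul_of_nonneg_left ?_ (abs_nonneg _)
  rw [← Real.rpow_two]
  refine Real.rpow_le_rpow_of_exponent_le hx ?_
  have : (0 : ℝ) ≤ n := n.cast_nonneg
  linarith

lemma abs_logKernelDeriv_le (ρ η : ℝ) (n : ℕ) {x : ℝ} (hx : 1 ≤ x) :
    |logKernelDeriv ρ η n x|
      ≤ (|ρ| + |η| + |η / 2 * ∏ k ∈ Finset.range (n - 2), (-(k : ℝ) - 1)|) * x ^ 2 := by
  have hρ := abs_nonneg ρ
  have hη := abs_nonneg η
  have h0 : 0 < x := by linarith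
  have hl := Real.log_nonneg hx
  have hl1 := Real.log_le_sub_one_of_pos h0
  have hx2 : x ≤ x ^ 2 := by nlinarith
  rcases n with _ | _ | n
  · have h1 : |ρ * x| ≤ |ρ| * x ^ 2 := by
      rw [abs_mul, abs_of_pos h0]; exact mul_le_mul_of_nonneg_left hx2 hρ
    have h2 : |η * (x * Real.log x)| ≤ |η| * x ^ 2 := by
      rw [abs_mul, abs_of_nonneg (mul_nonneg h0.le hl)]
      exact mul_le_mul_of_nonneg_left (by nlinarith) hη
    have h3 : |η / 2 * ∏ k ∈ Finset.range (0 - 2), (-(k : ℝ) - 1)| = |η| / 2 := by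
      simp [abs_div]
    have h4 := abs_add_le (ρ * x) (η * (x * Real.log x))
    have h5 : 0 ≤ |ρ| * x ^ 2 := by positivity
    have h6 : 0 ≤ |η| * x ^ 2 := by positivity
    rw [h3]
    simp only [logKernelDeriv]
    rw [abs_div, abs_two]
    linarith
  · have h1 : |ρ| ≤ |ρ| * x ^ 2 := le_mul_of_one_le_right hρ (by nlinarith)
    have h2 : |η * (Real.log x + 1)| ≤ |η| * x ^ 2 := by
      rw [abs_mul, abs_of_nonneg (by linarith : 0 ≤ Real.log x + 1)]
      exact mul_le_mul_of_nonneg_left (by linarith) hη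
    have h3 : |η / 2 * ∏ k ∈ Finset.range (0 + 1 - 2), (-(k : ℝ) - 1)| = |η| / 2 := by
      simp [abs_div]
    have h4 := abs_add_le ρ (η * (Real.log x + 1))
    have h5 : 0 ≤ |η| * x ^ 2 := by positivity
    rw [h3]
    simp only [logKernelDeriv]
    rw [abs_div, abs_two]
    have h6 : 0 ≤ |ρ| * x ^ 2 := by positivity
    linarith
  · rw [show n + 1 + 1 - 2 = n by omega]
    simp only [logKernelDeriv]
    rw [abs_mul, abs_of_nonneg (Real.rpow_nonneg h0.le _)]
    have h1 : x ^ (-1 - (n : ℝ)) ≤ 1 := by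
      refine Real.rpow_le_one_of_one_le_of_nonpos hx ?_
      have : (0 : ℝ) ≤ n := n.cast_nonneg
      linarith
    refine mul_le_mul (by linarith) (by nlinarith) (Real.rpow_nonneg h0.le _) (by positivity)

end Kernels

section MainExpansion

variable {Ω : Type*} [MeasurableSpace Ω] {P : Measure Ω} [IsProbabilityMeasure P]

/-- The terms `c (t + s)`, `c (t + s - y)`, `c (-t)` and `c (x - t)` of the covariances cancel: only
`s` and the increments `x`, `y` remain. -/
lemma covariance_fOU_of_kernel {h α ν : Fin 2 → ℝ} {B Y : Fin 2 → ℝ → Ω → ℝ}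
    (hh : ∀ i, 0 < h i ∧ h i ≤ 1) (hα : ∀ i, 0 < α i)
    (hB : IsBivariateFBm P h B) (hY : IsBivariateFOU P α ν B Y) {i j : Fin 2} {c : ℝ → ℝ}
    (hγ : ∀ u v, cov[B i u, B j v; P] = c v + c (-u) - c (v - u)) (t s : ℝ) :
    cov[Y i t, Y j (t + s); P] = ν i * ν j *
      ∫ y, ∫ x, (c (s + x) - c (s + 0) + c (s + -y) - c (s + (x + -y)))
        ∂(expMeasure (α i)) ∂(expMeasure (α j)) := by
  rw [covariance_fOU hh hα hB hY]
  congr 1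
  refine integral_congr_ae (ae_of_all _ fun y => integral_congr_ae (ae_of_all _ fun x => ?_))
  simp only [hγ]
  rw [show t + s - t = s + 0 by ring, show t + s - y - t = s + -y by ring,
    show t + s - (t - x) = s + x by ring, show t + s - y - (t - x) = s + (x + -y) by ring]
  ring

lemma isBigO_covariance_fOU_of_ne_one {h α ν : Fin 2 → ℝ} {B Y : Fin 2 → ℝ → Ω → ℝ}
    (hh : ∀ i, 0 < h i ∧ h i ≤ 1) (hα : ∀ i, 0 < α i)
    (hB : IsBivariateFBm P h B) (hY : IsBivariateFOU P α ν B Y) {ρ : ℝ} {η : Fin 2 → Fin 2 → ℝ}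
    (hρη : IsCrossCovParam P h B ρ η) {i j : Fin 2} (hij : i ≠ j) (N : ℕ) (t : ℝ)
    (hH1 : h 0 + h 1 ≠ 1) :
    (fun s : ℝ => cov[Y i t, Y j (t + s); P]
        - ν 0 * ν 1 * (ρ + η j i) / (2 * (α 0 + α 1)) *
          ∑ n ∈ Finset.range (N + 1),
            ((-1) ^ n / α j ^ (n + 1) + 1 / α i ^ (n + 1))
              * (∏ k ∈ Finset.range (n + 2), (h 0 + h 1 - (k : ℝ)))
              * s ^ (h 0 + h 1 - 2 - (n : ℝ)))
      =O[atTop] fun s : ℝ => s ^ (h 0 + h 1 - (N : ℝ) - 3) := by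
  set H := h 0 + h 1 with hHdef
  have hH0 : 0 < H := add_pos (hh 0).1 (hh 1).1
  have hH2 : H ≤ 2 := by linarith [(hh 0).2, (hh 1).2]
  have hN : (0 : ℝ) ≤ N := N.cast_nonneg
  have hγ : ∀ u v, cov[B i u, B j v; P] = powerKernel H ρ (η i j) v + powerKernel H ρ (η i j) (-u)
      - powerKernel H ρ (η i j) (v - u) := by
    intro u v
    rw [hρη.cov_of_ne_one hH1 i j hij]
    simp only [powerKernel, abs_neg]
    have := pmSign_neg_mul_abs_rpow hH0 u
    linear_combination (1 / 2) * η i j * this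
  have key := isBigO_integral_increment (N := N) (β := H - N - 3) (hα i) (hα j)
    (measurable_powerKernel H ρ (η i j))
    (fun x hx => powerKernelDeriv_zero H ρ (η i j) hx)
    (fun n x hx => hasDerivAt_powerKernelDeriv H ρ (η i j) n hx)
    (abs_powerKernel_le hH0 hH2 ρ (η i j))
    (fun n x hx => abs_powerKernelDeriv_le hH2 ρ (η i j) n hx)
    (fun x hx => le_of_eq (by
      rw [powerKernelDeriv, abs_mul, abs_of_nonneg (Real.rpow_nonneg hx.le _)]
      congr 2
      push_cast
      ring)) (by linarith) (by linarith)
  refine (key.const_mul_left (ν i * ν j)).congr_left fun s => ?_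
  rw [covariance_fOU_of_kernel hh hα hB hY hγ, mul_sub]
  congr 1
  rw [Finset.mul_sum, Finset.mul_sum]
  refine Finset.sum_congr rfl fun n _ => ?_
  have hν : ν i * ν j = ν 0 * ν 1 := by
    fin_cases i <;> fin_cases j <;> simp_all [mul_comm]
  have hαα : α i + α j = α 0 + α 1 := by
    fin_cases i <;> fin_cases j <;> simp_all [add_comm]
  have hη : η j i = -η i j := hρη.eta_antisymm j i
  have hpos : α 0 + α 1 ≠ 0 := (add_pos (hα 0) (hα 1)).ne'
  rw [hν, hαα, hη, powerKernelDeriv, show H - ((n + 2 : ℕ) : ℝ) = H - 2 - n by push_cast; ring]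
  field_simp
  ring

lemma isBigO_covariance_fOU_of_eq_one {h α ν : Fin 2 → ℝ} {B Y : Fin 2 → ℝ → Ω → ℝ}
    (hh : ∀ i, 0 < h i ∧ h i ≤ 1) (hα : ∀ i, 0 < α i)
    (hB : IsBivariateFBm P h B) (hY : IsBivariateFOU P α ν B Y) {ρ : ℝ} {η : Fin 2 → Fin 2 → ℝ}
    (hρη : IsCrossCovParam P h B ρ η) {i j : Fin 2} (hij : i ≠ j) (N : ℕ) (t : ℝ)
    (hH1 : h 0 + h 1 = 1) :
    (fun s : ℝ => cov[Y i t, Y j (t + s); P]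
        - (ν 0 * ν 1 * η i j / (2 * α 0 * α 1) * (1 / s)
          + ν 0 * ν 1 * η i j / (2 * (α 0 + α 1)) *
            ∑ n ∈ Finset.Icc 1 N,
              ((-1) ^ n / α j ^ (n + 1) + 1 / α i ^ (n + 1))
                * (∏ k ∈ Finset.range n, (-(k : ℝ) - 1))
                * s ^ (-1 - (n : ℝ))))
      =O[atTop] fun s : ℝ => s ^ (-(N : ℝ) - 2) := by
  have hN : (0 : ℝ) ≤ N := N.cast_nonneg
  have hγ : ∀ u v, cov[B i u, B j v; P] = logKernel ρ (η i j) v + logKernel ρ (η i j) (-u)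
      - logKernel ρ (η i j) (v - u) := by
    intro u v
    rw [hρη.cov_of_eq_one hH1 i j hij]
    simp only [logKernel, abs_neg]
    ring
  have key := isBigO_integral_increment (N := N) (β := -(N : ℝ) - 2) (hα i) (hα j)
    (measurable_logKernel ρ (η i j))
    (fun x hx => logKernelDeriv_zero ρ (η i j) hx)
    (fun n x hx => hasDerivAt_logKernelDeriv ρ (η i j) n hx)
    (abs_logKernel_le ρ (η i j))
    (fun n x hx => abs_logKernelDeriv_le ρ (η i j) n hx)
    (fun x hx => le_of_eq (by
      simp only [logKernelDeriv]
      rw [abs_mul, abs_of_nonneg (Real.rpow_nonneg hx.le _)]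
      congr 2
      push_cast
      ring)) (by linarith) (by linarith)
  refine (key.const_mul_left (ν i * ν j)).congr_left fun s => ?_
  rw [covariance_fOU_of_kernel hh hα hB hY hγ, mul_sub]
  congr 1
  have hν : ν i * ν j = ν 0 * ν 1 := by
    fin_cases i <;> fin_cases j <;> simp_all [mul_comm]
  have hαα : α i + α j = α 0 + α 1 := by
    fin_cases i <;> fin_cases j <;> simp_all [add_comm]
  have hαα' : α i * α j = α 0 * α 1 := by
    fin_cases i <;> fin_cases j <;> simp_all [mul_comm]
  have hpos : α 0 + α 1 ≠ 0 := (add_pos (hα 0) (hα 1)).ne'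
  have hi := (hα i).ne'
  have hj := (hα j).ne'
  rw [Finset.mul_sum, Finset.range_eq_Ico, Finset.sum_eq_sum_Ico_succ_bot (Nat.succ_pos N),
    Finset.mul_sum, show Finset.Ico (0 + 1) (N + 1) = Finset.Icc 1 N from rfl]
  congr 1
  -- the term `n = 0` of the general expansion is the separate `1 / s` term
  · have e : 1 / (2 * α 0 * α 1) = 1 / (2 * (α i * α j)) := by rw [hαα', mul_assoc]
    rw [hν, div_eq_mul_one_div (ν 0 * ν 1 * η i j) (2 * α 0 * α 1), e]
    have hij0 : α i + α j ≠ 0 := (add_pos (hα i) (hα j)).ne'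
    simp only [logKernelDeriv, Finset.range_zero, Finset.prod_empty, Nat.cast_zero, sub_zero,
      Real.rpow_neg_one, pow_zero, zero_add, pow_one]
    field_simp
  · refine Finset.sum_congr rfl fun n _ => ?_
    rw [hν, hαα]
    simp only [logKernelDeriv]
    field_simp

end MainExpansion

/-! ### The form of self-similar cross-covariances -/

section CompletelyAdditive

/-- A completely additive arithmetic function with `g 2 = 0` whose increments tend to zero
vanishes: halving gives `|g n| ≤ C + ε * Nat.log 2 n`, which is then applied to powers of `n`. -/
lemma eq_zero_of_completelyAdditive {g : ℕ → ℝ}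
    (hg : ∀ m n, 1 ≤ m → 1 ≤ n → g (m * n) = g m + g n) (h2 : g 2 = 0)
    (hlim : Tendsto (fun n => g (n + 1) - g n) atTop (𝓝 0)) {n : ℕ} (hn : 1 ≤ n) : g n = 0 := by
  have hpow : ∀ m : ℕ, g (n ^ m) = m * g n := by
    intro m
    induction m with
    | zero =>
      have := hg 1 1 le_rfl le_rfl
      simp only [mul_one] at this
      simp only [pow_zero, Nat.cast_zero, zero_mul]
      linarith
    | succ m ih =>
      rw [pow_succ, hg _ _ (Nat.one_le_pow _ _ hn) hn, ih]
      push_cast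
      ring
  have hbound : ∀ ε > 0, ∃ C, ∀ k, 1 ≤ k → |g k| ≤ C + ε * Nat.log 2 k := by
    intro ε hε
    obtain ⟨M, hM⟩ := Metric.tendsto_atTop.1 hlim ε hε
    refine ⟨∑ k ∈ Finset.range (2 * M + 2), |g k|, fun k => ?_⟩
    induction k using Nat.strong_induction_on with
    | _ k ih =>
      intro hk
      rcases lt_or_ge k (2 * M + 2) with hkM | hkM
      · have h1 : |g k| ≤ ∑ k ∈ Finset.range (2 * M + 2), |g k| :=
          Finset.single_le_sum (f := fun k => |g k|) (fun _ _ => abs_nonneg _)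
            (Finset.mem_range.2 hkM)
        have : 0 ≤ ε * (Nat.log 2 k : ℝ) := by positivity
        linarith
      · have h1 := ih (k / 2) (by omega) (by omega)
        have h3 : Nat.log 2 k = Nat.log 2 (k / 2) + 1 :=
          Nat.log_of_one_lt_of_le one_lt_two (by omega)
        have h4 : g (2 * (k / 2)) = g (k / 2) := by
          rw [hg 2 _ (by norm_num) (by omega), h2, zero_add]
        have h5 : |g k| ≤ |g (k / 2)| + ε := by
          rcases Nat.even_or_odd' k with ⟨q, rfl | rfl⟩
          · rw [← h4, Nat.mul_div_cancel_left q two_pos]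
            linarith
          · have h6 : (2 * q + 1) / 2 = q := by omega
            rw [h6] at h4 ⊢
            have h7 := hM (2 * q) (by omega)
            rw [Real.dist_eq, sub_zero, h4] at h7
            have := abs_sub_abs_le_abs_sub (g (2 * q + 1)) (g q)
            linarith
        rw [h3]
        push_cast
        linarith
  by_contra hne
  have hpos : 0 < |g n| := abs_pos.2 hne
  have hn0 : (0 : ℝ) < n := by exact_mod_cast hn
  obtain ⟨C, hC⟩ := hbound (|g n| / (2 * n)) (by positivity)
  obtain ⟨m, hm⟩ := exists_nat_gt (2 * C / |g n|)
  have h1 := hC (n ^ m) (Nat.one_le_pow _ _ hn)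
  rw [hpow, abs_mul, Nat.abs_cast] at h1
  have h2 : Nat.log 2 (n ^ m) ≤ n * m := by
    calc Nat.log 2 (n ^ m) ≤ Nat.log 2 ((2 ^ n) ^ m) :=
          Nat.log_mono_right (Nat.pow_le_pow_left Nat.lt_two_pow_self.le _)
      _ = n * m := by rw [← pow_mul, Nat.log_pow one_lt_two]
  have h3 : (Nat.log 2 (n ^ m) : ℝ) ≤ n * m := by exact_mod_cast h2
  have h4 : |g n| / (2 * n) * Nat.log 2 (n ^ m) ≤ |g n| / (2 * n) * (n * m) :=
    mul_le_mul_of_nonneg_left h3 (by positivity)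
  have h5 : |g n| / (2 * n) * (n * m) = m * |g n| / 2 := by field_simp
  rw [div_lt_iff₀ hpos] at hm
  linarith

/-- A completely additive arithmetic function whose increments tend to zero is a multiple of the
logarithm. -/
lemma exists_eq_mul_log_of_completelyAdditive {ψ : ℕ → ℝ}
    (hψ : ∀ m n, 1 ≤ m → 1 ≤ n → ψ (m * n) = ψ m + ψ n)
    (hlim : Tendsto (fun n => ψ (n + 1) - ψ n) atTop (𝓝 0)) :
    ∃ κ : ℝ, ∀ n, 1 ≤ n → ψ n = κ * Real.log n := by
  have hlog2 : Real.log 2 ≠ 0 := (Real.log_pos one_lt_two).ne'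
  refine ⟨ψ 2 / Real.log 2, fun n hn => ?_⟩
  have := eq_zero_of_completelyAdditive
    (g := fun n => ψ n - ψ 2 / Real.log 2 * Real.log n) ?_ ?_ ?_ hn
  · linarith
  · intro m n hm hn
    have hm0 : (m : ℝ) ≠ 0 := by exact_mod_cast (by omega : m ≠ 0)
    have hn0 : (n : ℝ) ≠ 0 := by exact_mod_cast (by omega : n ≠ 0)
    rw [hψ m n hm hn, Nat.cast_mul, Real.log_mul hm0 hn0]
    ring
  · simp only [Nat.cast_ofNat]
    field_simp
    ring
  · have h1 : Tendsto (fun n : ℕ => Real.log (n + 1) - Real.log n) atTop (𝓝 0) :=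
      Real.tendsto_log_nat_add_one_sub_log
    have h2 := hlim.sub (h1.const_mul (ψ 2 / Real.log 2))
    simp only [mul_zero, sub_zero] at h2
    refine h2.congr fun n => ?_
    push_cast
    ring

end CompletelyAdditive

section CrossCovarianceForm

lemma exists_int_antidifference (e : ℤ → ℝ) :
    ∃ c : ℤ → ℝ, c 0 = 0 ∧ ∀ n, c (n + 1) - c n = e n := by
  refine ⟨fun n => ∑ k ∈ Finset.Ico 0 n, e k - ∑ k ∈ Finset.Ico n 0, e k, by simp, fun n => ?_⟩
  rcases le_or_gt 0 n with hn | hn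
  · have h1 : Finset.Ico 0 (n + 1) = insert n (Finset.Ico 0 n) := by
      ext k; simp only [Finset.mem_Ico, Finset.mem_insert]; omega
    have h2 : Finset.Ico (n + 1) 0 = ∅ := Finset.Ico_eq_empty (by omega)
    have h3 : Finset.Ico n 0 = ∅ := Finset.Ico_eq_empty (by omega)
    simp only [h1, h2, h3]
    rw [Finset.sum_insert (by simp)]
    simp
  · have h1 : Finset.Ico n 0 = insert n (Finset.Ico (n + 1) 0) := by
      ext k; simp only [Finset.mem_Ico, Finset.mem_insert]; omega
    have h2 : Finset.Ico 0 (n + 1) = ∅ := Finset.Ico_eq_empty (by omega)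
    have h3 : Finset.Ico 0 n = ∅ := Finset.Ico_eq_empty (by omega)
    simp only [h1, h2, h3]
    rw [Finset.sum_insert (by simp)]
    simp

lemma int_eq_of_forall_succ {d e : ℤ → ℝ} (h0 : d 0 = e 0)
    (h : ∀ n, d (n + 1) - d n = e (n + 1) - e n) (n : ℤ) : d n = e n := by
  induction n using Int.induction_on with
  | zero => exact h0
  | succ n ih => linarith [h n]
  | pred n ih =>
    have := h (-(n : ℤ) - 1)
    rw [sub_add_cancel] at this
    linarith

/-- The properties of the cross-covariance function of a bivariate fractional Brownian motion that
determine its form. -/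
structure IsSelfSimilarCrossCov (H : ℝ) (γ : ℝ → ℝ → ℝ) : Prop where
  zero_left : ∀ s, γ 0 s = 0
  zero_right : ∀ t, γ t 0 = 0
  increments : ∀ u t s, γ (t + u) (s + u) - γ (t + u) u - γ u (s + u) + γ u u = γ t s
  selfSimilar : ∀ a, 0 < a → ∀ t s, γ (a * t) (a * s) = a ^ H * γ t s
  continuous_left : ∀ s, Continuous fun t => γ t s
  continuous_right : ∀ t, Continuous fun s => γ t s

namespace IsSelfSimilarCrossCov

variable {H : ℝ} {γ : ℝ → ℝ → ℝ}

/-- On the integer lattice, `γ` is expressed by a second antidifference `c` of the covariances of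
unit increments, normalized by `c 0 = c 1 = 0`. -/
lemma exists_lattice_kernel (hγ : IsSelfSimilarCrossCov H γ) :
    ∃ c : ℤ → ℝ, c 0 = 0 ∧ c 1 = 0 ∧ ∀ m n : ℤ, γ m n = c n + c (-m) - c (n - m) := by
  obtain ⟨c, hc0, hc⟩ := exists_int_antidifference fun n => γ 1 (n + 1 : ℤ) - γ 1 1
  have hc1 : c 1 = 0 := by simpa [hc0] using hc 0
  refine ⟨c, hc0, hc1, fun m n => ?_⟩
  refine int_eq_of_forall_succ (d := fun m : ℤ => γ m n)
    (e := fun m : ℤ => c n + c (-m) - c (n - m)) ?_ (fun m => ?_) m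
  · simp [hγ.zero_left, hc0]
  · have h1 := hγ.increments m 1 (n - m)
    have h2 := hγ.increments m 1 (-m)
    rw [sub_add_cancel, add_comm (1 : ℝ)] at h1
    rw [neg_add_cancel, add_comm (1 : ℝ), hγ.zero_right, hγ.zero_right] at h2
    have h3 := hc (n - (m + 1))
    have h4 := hc (-(m + 1))
    rw [show n - (m + 1) + 1 = n - m by ring] at h3
    rw [show -(m + 1) + 1 = -m by ring] at h4
    push_cast at h3 h4 ⊢
    linarith

/-- Self-similarity of `γ` on the lattice, in terms of the kernel `c`. -/
lemma lattice_kernel_mul (hγ : IsSelfSimilarCrossCov H γ) {c : ℤ → ℝ} (hc0 : c 0 = 0)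
    (hc1 : c 1 = 0) (hc : ∀ m n : ℤ, γ m n = c n + c (-m) - c (n - m)) {p : ℕ} (hp : 1 ≤ p)
    (k : ℤ) : c (p * k) = (p : ℝ) ^ H * c k + k * c p := by
  have hp0 : (0 : ℝ) < p := by exact_mod_cast hp
  have hd : ∀ m n : ℤ, (c (p * n) - (p : ℝ) ^ H * c n) + (c (p * -m) - (p : ℝ) ^ H * c (-m))
      - (c (p * (n - m)) - (p : ℝ) ^ H * c (n - m)) = 0 := by
    intro m n
    have h1 := hγ.selfSimilar p hp0 m n
    have h2 := hc (p * m) (p * n)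
    push_cast at h2
    rw [h1, hc m n, ← mul_neg, ← mul_sub] at h2
    linarith
  have := int_eq_of_forall_succ (d := fun k => c (p * k) - (p : ℝ) ^ H * c k)
    (e := fun k => k * c p) (by simp [hc0]) (fun n => ?_) k
  · linarith
  · have h1 := hd 1 (n + 1)
    have h2 := hd 1 1
    simp only [sub_self, mul_zero, mul_one, hc0, hc1, add_sub_cancel_right] at h1 h2
    push_cast
    linarith

/-- Two self-similar functions that agree on the integer lattice agree everywhere. -/
lemma eq_of_eq_on_lattice (hγ : IsSelfSimilarCrossCov H γ) {F : ℝ → ℝ → ℝ}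
    (hFs : ∀ a, 0 < a → ∀ t s, F (a * t) (a * s) = a ^ H * F t s)
    (hFl : ∀ s, Continuous fun t => F t s) (hFr : ∀ t, Continuous fun s => F t s)
    (h : ∀ m n : ℤ, γ m n = F m n) (t s : ℝ) : γ t s = F t s := by
  have hq : ∀ x y : ℚ, γ x y = F x y := by
    intro x y
    have hd : (0 : ℝ) < (x.den : ℝ) * y.den := by
      have h1 : (0 : ℝ) < x.den := by exact_mod_cast x.den_pos
      have h2 : (0 : ℝ) < y.den := by exact_mod_cast y.den_pos
      positivity
    have hx : (x.den : ℝ) * y.den * x = ((x.num * y.den : ℤ) : ℝ) := by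
      have h1 : (x : ℝ) * x.den = x.num := by exact_mod_cast Rat.mul_den_eq_num x
      push_cast
      rw [← h1]
      ring
    have hy : (x.den : ℝ) * y.den * y = ((y.num * x.den : ℤ) : ℝ) := by
      have h1 : (y : ℝ) * y.den = y.num := by exact_mod_cast Rat.mul_den_eq_num y
      push_cast
      rw [← h1]
      ring
    have h1 := hγ.selfSimilar _ hd x y
    have h2 := hFs _ hd x y
    rw [hx, hy] at h1 h2
    rw [h, h2] at h1
    exact (mul_left_cancel₀ (Real.rpow_pos_of_pos hd H).ne' h1).symm
  have h1 : ∀ (x : ℚ) (s : ℝ), γ x s = F x s := fun x s =>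
    congrFun (Rat.denseRange_cast.equalizer (hγ.continuous_right x) (hFr x)
      (funext fun y => hq x y)) s
  exact congrFun (Rat.denseRange_cast.equalizer (hγ.continuous_left s) (hFl s)
    (funext fun x => h1 x s)) t

end IsSelfSimilarCrossCov

lemma continuous_powerKernel {H : ℝ} (hH : 0 < H) (ρ η : ℝ) : Continuous (powerKernel H ρ η) := by
  have e : powerKernel H ρ η = fun x => (ρ * |x| ^ H - η * (max x 0 ^ H - max (-x) 0 ^ H)) / 2 := by
    ext x
    unfold powerKernel
    rcases lt_or_ge x 0 with hx | hx
    · rw [pmSign_of_neg hx, max_eq_right hx.le, max_eq_left (by linarith), abs_of_neg hx,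
        Real.zero_rpow hH.ne']
      ring
    · rw [pmSign_of_nonneg hx, max_eq_left hx, max_eq_right (by linarith), abs_of_nonneg hx,
        Real.zero_rpow hH.ne']
      ring
  rw [e]
  have h1 : Continuous fun x : ℝ => |x| ^ H :=
    Continuous.rpow_const (by fun_prop) fun _ => Or.inr hH.le
  have h2 : Continuous fun x : ℝ => max x 0 ^ H :=
    Continuous.rpow_const (by fun_prop) fun _ => Or.inr hH.le
  have h3 : Continuous fun x : ℝ => max (-x) 0 ^ H :=
    Continuous.rpow_const (by fun_prop) fun _ => Or.inr hH.le
  fun_prop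

lemma continuous_logKernel (ρ η : ℝ) : Continuous (logKernel ρ η) := by
  unfold logKernel
  simp_rw [Real.log_abs]
  have := Real.continuous_mul_log
  fun_prop

lemma powerKernel_mul {H a : ℝ} (ha : 0 < a) (ρ η x : ℝ) :
    powerKernel H ρ η (a * x) = a ^ H * powerKernel H ρ η x := by
  have h1 : pmSign (a * x) = pmSign x := by
    unfold pmSign
    simp only [mul_nonneg_iff_of_pos_left ha]
  unfold powerKernel
  rw [h1, abs_mul, abs_of_pos ha, Real.mul_rpow ha.le (abs_nonneg _)]
  ring

/-- The kernel is homogeneous of degree one up to a linear function. -/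
lemma logKernel_mul {a : ℝ} (ha : 0 < a) (ρ η x : ℝ) :
    logKernel ρ η (a * x) = a * logKernel ρ η x + η * a * Real.log a / 2 * x := by
  unfold logKernel
  rcases eq_or_ne x 0 with rfl | hx
  · simp
  · rw [abs_mul, abs_of_pos ha, Real.log_mul ha.ne' (abs_pos.2 hx).ne']
    ring

namespace IsSelfSimilarCrossCov

variable {H : ℝ} {γ : ℝ → ℝ → ℝ}

lemma exists_powerKernel (hγ : IsSelfSimilarCrossCov H γ) (hH : 0 < H) (hH1 : H ≠ 1) :
    ∃ η, ∀ t s, γ t s = powerKernel H (γ 1 1) η s + powerKernel H (γ 1 1) η (-t)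
      - powerKernel H (γ 1 1) η (s - t) := by
  obtain ⟨c, hc0, hc1, hc⟩ := hγ.exists_lattice_kernel
  have hmul := fun (p : ℕ) (hp : 1 ≤ p) (k : ℤ) => hγ.lattice_kernel_mul hc0 hc1 hc hp k
  have hρ : γ 1 1 = c (-1) := by
    have := hc 1 1
    push_cast at this
    rw [this, hc0, hc1]
    ring
  rw [hρ]
  have h2 : (2 : ℝ) ^ H - 2 ≠ 0 := by
    rw [sub_ne_zero]
    intro h
    refine hH1 ((Real.rpow_right_inj (x := 2) (by norm_num) (by norm_num)).1 ?_)
    rw [h, Real.rpow_one]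
  set κ := c 2 / (2 ^ H - 2) with hκ
  have hpos : ∀ p : ℕ, 1 ≤ p → c p = κ * ((p : ℝ) ^ H - p) := by
    intro p hp
    have h3 := hmul p hp 2
    have h4 := hmul 2 (by norm_num) p
    rw [mul_comm (p : ℤ) 2] at h3
    push_cast at h3 h4
    rw [h4] at h3
    rw [hκ, div_mul_eq_mul_div, eq_div_iff h2]
    linarith
  -- `κ` and `c (-1) - κ` are the coefficients of `|x| ^ H` on the two half-lines, that is,
  -- `(ρ - η) / 2` and `(ρ + η) / 2`
  have hkernel : ∀ k : ℤ, c k = powerKernel H (c (-1)) (c (-1) - 2 * κ) k - κ * k := by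
    intro k
    rcases lt_trichotomy k 0 with hk | rfl | hk
    · obtain ⟨p, hp⟩ := Int.eq_ofNat_of_zero_le (by omega : 0 ≤ -k)
      obtain rfl : k = p * (-1) := by omega
      have hp1 : 1 ≤ p := by omega
      have hp0 : (0 : ℝ) < p := by exact_mod_cast hp1
      rw [hmul p hp1, hpos p hp1, powerKernel]
      push_cast
      rw [pmSign_of_neg (by linarith), abs_of_neg (by linarith),
        show -((p : ℝ) * -1) = p by ring]
      ring
    · simp [hc0, powerKernel, Real.zero_rpow hH.ne']
    · obtain ⟨p, rfl⟩ := Int.eq_ofNat_of_zero_le hk.le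
      have hp1 : 1 ≤ p := by omega
      have hp0 : (0 : ℝ) < p := by exact_mod_cast hp1
      rw [hpos p hp1, powerKernel]
      push_cast
      rw [pmSign_of_nonneg hp0.le, abs_of_pos hp0]
      ring
  refine ⟨c (-1) - 2 * κ, hγ.eq_of_eq_on_lattice (F := fun t s => _) ?_ ?_ ?_ ?_⟩
  · intro a ha t s
    rw [← mul_neg, ← mul_sub, powerKernel_mul ha, powerKernel_mul ha, powerKernel_mul ha]
    ring
  · intro s
    have := continuous_powerKernel hH (c (-1)) (c (-1) - 2 * κ)
    fun_prop
  · intro t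
    have := continuous_powerKernel hH (c (-1)) (c (-1) - 2 * κ)
    fun_prop
  · intro m n
    rw [hc, hkernel n, hkernel (-m), hkernel (n - m)]
    push_cast
    ring

lemma exists_logKernel (hγ : IsSelfSimilarCrossCov 1 γ) :
    ∃ η, ∀ t s, γ t s = logKernel (γ 1 1) η s + logKernel (γ 1 1) η (-t)
      - logKernel (γ 1 1) η (s - t) := by
  obtain ⟨c, hc0, hc1, hc⟩ := hγ.exists_lattice_kernel
  have hmul : ∀ (p : ℕ), 1 ≤ p → ∀ k : ℤ, c (p * k) = p * c k + k * c p := fun p hp k => by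
    simpa using hγ.lattice_kernel_mul hc0 hc1 hc hp k
  have hρ : γ 1 1 = c (-1) := by
    have := hc 1 1
    push_cast at this
    rw [this, hc0, hc1]
    ring
  -- the increments of `c` are `o(n)`, by continuity of `γ 1` at `1`
  have hinc : Tendsto (fun n : ℕ => (c (n + 1 : ℕ) - c n) / n) atTop (𝓝 0) := by
    have h1 : Tendsto (fun n : ℕ => γ 1 (1 + 1 / n)) atTop (𝓝 (γ 1 1)) := by
      have h2 : Tendsto (fun n : ℕ => 1 + 1 / (n : ℝ)) atTop (𝓝 1) := by
        simpa using tendsto_one_div_atTop_nhds_zero_nat.const_add (1 : ℝ)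
      exact ((hγ.continuous_right 1).tendsto 1).comp h2
    have h3 := h1.sub_const (γ 1 1)
    rw [sub_self] at h3
    refine h3.congr' ?_
    filter_upwards [eventually_ge_atTop 1] with n hn
    have hn0 : (0 : ℝ) < n := by exact_mod_cast hn
    have h4 := hγ.selfSimilar n hn0 1 (1 + 1 / n)
    have h5 := hc n (n + 1 : ℕ)
    have h6 := hmul n hn (-1)
    rw [mul_neg_one] at h6
    rw [show (((n + 1 : ℕ) : ℤ) - n : ℤ) = 1 by push_cast; ring, hc1, h6] at h5
    rw [Real.rpow_one, mul_one, show (n : ℝ) * (1 + 1 / n) = n + 1 by field_simp] at h4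
    push_cast at h5 ⊢
    rw [h4] at h5
    rw [hρ, eq_div_iff hn0.ne']
    linarith
  have hψ : ∃ κ : ℝ, ∀ n : ℕ, 1 ≤ n → c n / n = κ * Real.log n := by
    refine exists_eq_mul_log_of_completelyAdditive (ψ := fun n : ℕ => c n / n) ?_ ?_
    · intro m n hm hn
      have hm0 : (m : ℝ) ≠ 0 := by exact_mod_cast (by omega : m ≠ 0)
      have hn0 : (n : ℝ) ≠ 0 := by exact_mod_cast (by omega : n ≠ 0)
      have := hmul m hm n
      push_cast at this ⊢
      rw [this]
      field_simp
      ring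
    · -- summation gives `c n = o(n ^ 2)`
      have hsq : Tendsto (fun n : ℕ => c n / (n : ℝ) ^ 2) atTop (𝓝 0) := by
        have h1 := hinc.norm.cesaro
        rw [norm_zero] at h1
        refine squeeze_zero_norm' ?_ h1
        filter_upwards [eventually_ge_atTop 1] with n hn
        have hn0 : (0 : ℝ) < n := by exact_mod_cast hn
        have h2 : c n = ∑ k ∈ Finset.range n, (c (k + 1 : ℕ) - c k) := by
          rw [Finset.sum_range_sub (fun k : ℕ => c k)]
          simp [hc0]
        have h3 : ∀ k ∈ Finset.range n, |c (k + 1 : ℕ) - c k|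
            ≤ n * ‖(c (k + 1 : ℕ) - c k) / k‖ := by
          intro k hk
          rcases Nat.eq_zero_or_pos k with rfl | hk0
          · simp [hc0, hc1]
          · have hk1 : (0 : ℝ) < k := by exact_mod_cast hk0
            have hkn : (k : ℝ) ≤ n := by exact_mod_cast (Finset.mem_range.1 hk).le
            rw [Real.norm_eq_abs, abs_div, abs_of_pos hk1, mul_div_assoc', le_div_iff₀ hk1,
              mul_comm]
            exact mul_le_mul_of_nonneg_right hkn (abs_nonneg _)
        have h4 : |c n| ≤ n * ∑ k ∈ Finset.range n, ‖(c (k + 1 : ℕ) - c k) / k‖ := by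
          rw [Finset.mul_sum]
          calc |c n| = |∑ k ∈ Finset.range n, (c (k + 1 : ℕ) - c k)| := by rw [← h2]
            _ ≤ _ := (Finset.abs_sum_le_sum_abs _ _).trans (Finset.sum_le_sum h3)
        rw [norm_div, norm_pow, Real.norm_eq_abs, Real.norm_eq_abs, abs_of_pos hn0,
          div_le_iff₀ (by positivity)]
        refine h4.trans_eq ?_
        field_simp
      have h1 : Tendsto (fun n : ℕ => c (n + 1 : ℕ) / ((n + 1 : ℕ) : ℝ) ^ 2 *
          (1 + 1 / (n : ℝ))) atTop (𝓝 0) := by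
        have h2 : Tendsto (fun n : ℕ => 1 + 1 / (n : ℝ)) atTop (𝓝 1) := by
          simpa using tendsto_one_div_atTop_nhds_zero_nat.const_add (1 : ℝ)
        simpa using ((tendsto_add_atTop_iff_nat 1).2 hsq).mul h2
      have h3 := hinc.sub h1
      rw [sub_zero] at h3
      refine h3.congr' ?_
      filter_upwards [eventually_ge_atTop 1] with n hn
      have hn0 : (0 : ℝ) < n := by exact_mod_cast hn
      push_cast
      field_simp
      ring
  obtain ⟨κ, hκ⟩ := hψ
  have hpos : ∀ p : ℕ, 1 ≤ p → c p = κ * (p * Real.log p) := by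
    intro p hp
    have hp0 : (p : ℝ) ≠ 0 := by exact_mod_cast (by omega : p ≠ 0)
    have := hκ p hp
    rw [div_eq_iff hp0] at this
    rw [this]
    ring
  rw [hρ]
  have hkernel : ∀ k : ℤ, c k = logKernel (c (-1)) (2 * κ) k - c (-1) / 2 * k := by
    intro k
    rcases lt_trichotomy k 0 with hk | rfl | hk
    · obtain ⟨p, hp⟩ := Int.eq_ofNat_of_zero_le (by omega : 0 ≤ -k)
      obtain rfl : k = p * (-1) := by omega
      have hp1 : 1 ≤ p := by omega
      have hp0 : (0 : ℝ) < p := by exact_mod_cast hp1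
      rw [hmul p hp1, hpos p hp1, logKernel]
      push_cast
      rw [abs_of_neg (by linarith), show -((p : ℝ) * -1) = p by ring]
      ring
    · simp [hc0, logKernel]
    · obtain ⟨p, rfl⟩ := Int.eq_ofNat_of_zero_le hk.le
      have hp1 : 1 ≤ p := by omega
      have hp0 : (0 : ℝ) < p := by exact_mod_cast hp1
      rw [hpos p hp1, logKernel]
      push_cast
      rw [abs_of_pos hp0]
      ring
  refine ⟨2 * κ, hγ.eq_of_eq_on_lattice (F := fun t s => _) ?_ ?_ ?_ ?_⟩
  · intro a ha t s
    rw [← mul_neg, ← mul_sub, logKernel_mul ha, logKernel_mul ha, logKernel_mul ha, Real.rpow_one]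
    ring
  · intro s
    have := continuous_logKernel (c (-1)) (2 * κ)
    fun_prop
  · intro t
    have := continuous_logKernel (c (-1)) (2 * κ)
    fun_prop
  · intro m n
    rw [hc, hkernel n, hkernel (-m), hkernel (n - m)]
    push_cast
    ring

end IsSelfSimilarCrossCov

end CrossCovarianceForm

/-! ### Existence of the cross-covariance parameters -/

section ExistenceOfParameters

variable {Ω : Type*} [MeasurableSpace Ω] {P : Measure Ω}

lemma covariance_eq_of_identDistrib {ι : Type*} {U V : Ω → ι → ℝ} (h : IdentDistrib U V P P)
    (a b : ι) :
    cov[fun ω => U ω a, fun ω => U ω b; P] = cov[fun ω => V ω a, fun ω => V ω b; P] := by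
  have ha := (h.comp (measurable_pi_apply a)).integral_eq
  have hb := (h.comp (measurable_pi_apply b)).integral_eq
  simp only [Function.comp_def] at ha hb
  unfold covariance
  rw [ha, hb]
  exact (h.comp (u := fun z : ι → ℝ => (z a - ∫ ω, V ω a ∂P) * (z b - ∫ ω, V ω b ∂P))
    (by fun_prop)).integral_eq

namespace IsBivariateFBm

variable {h : Fin 2 → ℝ} {B : Fin 2 → ℝ → Ω → ℝ}

lemma covariance_mul (hB : IsBivariateFBm P h B) (i j : Fin 2) {a : ℝ} (ha : 0 < a) (t s : ℝ) :
    cov[B i (a * t), B j (a * s); P] = a ^ (h i + h j) * cov[B i t, B j s; P] := by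
  classical
  have := covariance_eq_of_identDistrib (hB.selfSimilar a ha {(i, t), (j, s)})
    ⟨(i, t), by simp⟩ ⟨(j, s), by simp⟩
  rw [covariance_const_mul_left, covariance_const_mul_right, ← mul_assoc,
    ← Real.rpow_add ha] at this
  exact this

variable [IsProbabilityMeasure P]

lemma covariance_zero_left (hB : IsBivariateFBm P h B) (hh : ∀ i, 0 < h i) (i : Fin 2) {Z : Ω → ℝ}
    (hZ : MemLp Z 2 P) : cov[B i 0, Z; P] = 0 := by
  have h1 := abs_covariance_le ((hB.fBm i).memLp 0) hZ
  have h2 : (2 : ℝ) * h i ≠ 0 := by have := hh i; positivity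
  rw [(hB.fBm i).variance_eq (hh i), abs_zero, Real.zero_rpow h2, Real.sqrt_zero, zero_mul] at h1
  exact abs_nonpos_iff.1 h1

lemma covariance_increments (hB : IsBivariateFBm P h B) (hh : ∀ i, 0 < h i) (i j : Fin 2)
    (u t s : ℝ) :
    cov[B i (t + u), B j (s + u); P] - cov[B i (t + u), B j u; P] - cov[B i u, B j (s + u); P]
      + cov[B i u, B j u; P] = cov[B i t, B j s; P] := by
  classical
  have h2 := fun i u => (hB.fBm i).memLp u
  have h1 := covariance_eq_of_identDistrib (hB.stationaryIncrements u {(i, t), (j, s)})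
    ⟨(i, t), by simp⟩ ⟨(j, s), by simp⟩
  simp only at h1
  rw [covariance_fun_sub_fun_sub (h2 _ _) (h2 _ _) (h2 _ _) (h2 _ _),
    covariance_fun_sub_fun_sub (h2 _ _) (h2 _ _) (h2 _ _) (h2 _ _),
    hB.covariance_zero_left hh i (h2 _ _), hB.covariance_zero_left hh i (h2 _ _),
    covariance_comm (B i t) (B j 0), hB.covariance_zero_left hh j (h2 _ _)] at h1
  linarith

lemma isSelfSimilarCrossCov (hB : IsBivariateFBm P h B) (hh : ∀ i, 0 < h i) :
    IsSelfSimilarCrossCov (h 0 + h 1) fun t s => cov[B 0 t, B 1 s; P] where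
  zero_left s := hB.covariance_zero_left hh 0 ((hB.fBm 1).memLp s)
  zero_right t := by
    rw [covariance_comm]
    exact hB.covariance_zero_left hh 1 ((hB.fBm 0).memLp t)
  increments u t s := hB.covariance_increments hh 0 1 u t s
  selfSimilar _ ha t s := hB.covariance_mul 0 1 ha t s
  continuous_left s := (hB.fBm 0).continuous_covariance (hh 0) ((hB.fBm 1).memLp s)
  continuous_right t := by
    simp_rw [covariance_comm (B 0 t)]
    exact (hB.fBm 1).continuous_covariance (hh 1) ((hB.fBm 0).memLp t)

/-- The kernel is identified for the pair `(0, 1)`; the pair `(1, 0)` follows from the symmetry of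
the covariance, which replaces `η` by `-η`. -/
lemma exists_isCrossCovParam (hB : IsBivariateFBm P h B) (hh : ∀ i, 0 < h i) :
    ∃ (ρ : ℝ) (η : Fin 2 → Fin 2 → ℝ), IsCrossCovParam P h B ρ η := by
  have hγ := hB.isSelfSimilarCrossCov hh
  have hvar : ∀ i, Var[B i 1; P] = 1 := fun i => by
    rw [(hB.fBm i).variance_eq (hh i), abs_one, Real.one_rpow]
  have hρ : cov[B 0 1, B 1 1; P] ∈ Set.Icc (-1 : ℝ) 1 := by
    have h1 := abs_covariance_le ((hB.fBm 0).memLp 1) ((hB.fBm 1).memLp 1)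
    rw [hvar, hvar, Real.sqrt_one, one_mul] at h1
    exact abs_le.1 h1
  have hH : 0 < h 0 + h 1 := add_pos (hh 0) (hh 1)
  -- the antisymmetric matrix with entry `(0, 1)` equal to `e`
  have hη : ∀ e : ℝ, ∃ η : Fin 2 → Fin 2 → ℝ, (∀ i j, η i j = -η j i) ∧ η 0 1 = e ∧ η 1 0 = -e :=
    fun e => ⟨fun i j => if i = j then 0 else if i = 0 then e else -e, by
      intro i j
      fin_cases i <;> fin_cases j <;> simp, by simp, by simp⟩
  by_cases hH1 : h 0 + h 1 = 1
  · rw [hH1] at hγ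
    obtain ⟨e, he⟩ := hγ.exists_logKernel
    obtain ⟨η, hη, h01, h10⟩ := hη e
    refine ⟨_, η, hρ, by simp [hvar], hη, fun h => absurd hH1 h, fun _ i j hij t s => ?_⟩
    have h2 : ∀ t s, cov[B 0 t, B 1 s; P] = (cov[B 0 1, B 1 1; P] * (|s| + |t| - |s - t|)
        + e * (s * Real.log |s| - t * Real.log |t| - (s - t) * Real.log |s - t|)) / 2 := by
      intro t s
      rw [he t s]
      simp only [logKernel, abs_neg]
      ring
    fin_cases i <;> fin_cases j
    · exact absurd rfl hij
    · simp only [Fin.zero_eta, Fin.mk_one, h01]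
      exact h2 t s
    · simp only [Fin.zero_eta, Fin.mk_one, h10]
      rw [covariance_comm, h2 s t, abs_sub_comm t s]
      ring
    · exact absurd rfl hij
  · obtain ⟨e, he⟩ := hγ.exists_powerKernel hH hH1
    obtain ⟨η, hη, h01, h10⟩ := hη e
    refine ⟨_, η, hρ, by simp [hvar], hη, fun _ i j hij t s => ?_, fun h => absurd h hH1⟩
    have h2 : ∀ t s, cov[B 0 t, B 1 s; P] =
        ((cov[B 0 1, B 1 1; P] + pmSign t * e) * |t| ^ (h 0 + h 1)
          + (cov[B 0 1, B 1 1; P] - pmSign s * e) * |s| ^ (h 0 + h 1)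
          - (cov[B 0 1, B 1 1; P] - pmSign (s - t) * e) * |s - t| ^ (h 0 + h 1)) / 2 := by
      intro t s
      rw [he t s]
      simp only [powerKernel, abs_neg]
      linear_combination (-1 / 2) * e * pmSign_neg_mul_abs_rpow hH t
    fin_cases i <;> fin_cases j
    · exact absurd rfl hij
    · simp only [Fin.zero_eta, Fin.mk_one, h01]
      exact h2 t s
    · simp only [Fin.zero_eta, Fin.mk_one, h10]
      have h3 := pmSign_neg_mul_abs_rpow hH (s - t)
      rw [neg_sub] at h3
      rw [covariance_comm, h2 s t, abs_sub_comm t s]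
      linear_combination (1 / 2) * e * h3
    · exact absurd rfl hij

end IsBivariateFBm

end ExistenceOfParameters

theorem theorem5p4p8 {Ω : Type*} [MeasurableSpace Ω] (P : Measure Ω) [IsProbabilityMeasure P]
    (h α ν : Fin 2 → ℝ) (B Y : Fin 2 → ℝ → Ω → ℝ)
    (hh : ∀ i, 0 < h i ∧ h i ≤ 1 ∧ h i ≠ 1 / 2)
    (hα : ∀ i, 0 < α i) (hν : ∀ i, 0 < ν i)
    (hB : IsBivariateFBm P h B) (hY : IsBivariateFOU P α ν B Y) :
    (∃ (ρ : ℝ) (η : Fin 2 → Fin 2 → ℝ), IsCrossCovParam P h B ρ η) ∧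
    ∀ (ρ : ℝ) (η : Fin 2 → Fin 2 → ℝ), IsCrossCovParam P h B ρ η →
      ∀ i j : Fin 2, i ≠ j → ∀ (N : ℕ) (t : ℝ),
        (h 0 + h 1 ≠ 1 →
          (fun s : ℝ => cov[Y i t, Y j (t + s); P]
            - ν 0 * ν 1 * (ρ + η j i) / (2 * (α 0 + α 1)) *
              ∑ n ∈ Finset.range (N + 1),
                ((-1) ^ n / α j ^ (n + 1) + 1 / α i ^ (n + 1))
                  * (∏ k ∈ Finset.range (n + 2), (h 0 + h 1 - (k : ℝ)))
                  * s ^ (h 0 + h 1 - 2 - (n : ℝ)))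
            =O[atTop] fun s : ℝ => s ^ (h 0 + h 1 - (N : ℝ) - 3)) ∧
        (h 0 + h 1 = 1 →
          (fun s : ℝ => cov[Y i t, Y j (t + s); P]
            - (ν 0 * ν 1 * η i j / (2 * α 0 * α 1) * (1 / s)
              + ν 0 * ν 1 * η i j / (2 * (α 0 + α 1)) *
                ∑ n ∈ Finset.Icc 1 N,
                  ((-1) ^ n / α j ^ (n + 1) + 1 / α i ^ (n + 1))
                    * (∏ k ∈ Finset.range n, (-(k : ℝ) - 1))
                    * s ^ (-1 - (n : ℝ))))
            =O[atTop] fun s : ℝ => s ^ (-(N : ℝ) - 2)) := by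
  have hh' : ∀ i, 0 < h i ∧ h i ≤ 1 := fun i => ⟨(hh i).1, (hh i).2.1⟩
  exact ⟨hB.exists_isCrossCovParam fun i => (hh i).1, fun ρ η hρη i j hij N t =>
    ⟨isBigO_covariance_fOU_of_ne_one hh' hα hB hY hρη hij N t,
      isBigO_covariance_fOU_of_eq_one hh' hα hB hY hρη hij N t⟩⟩
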